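/- **Setting.** Let $(Z_i,Y_i)_{i\ge 1}$ be i.i.d. clusters with covariates $Z_i$ in a measurable space and square-integrable outcome vectors $Y_i\in\mathbb R^m$. Let $\mu(z,\theta)\in\mathbb R^m$, $\theta\in\mathbb R^p$, be a mean model with Jacobian $D(z,\theta)=\partial_\theta\mu(z,\theta)\in\mathbb R^{m\times p}$, and let $W(z,\theta)\in\mathbb R^{m\times m}$ be symmetric working matrices. The estimating function is $s(z,y,\theta)=D(z,\theta)^\top W(z,\theta)\{y-\mu(z,\theta)\}$. The outcomes have mean $\mu$, i.e. $\mathbb E[Y_i\mid Z_i]=\mu(Z_i,\theta_0)$ almost surely, and $\Sigma_i=\operatorname{Cov}(Y_i\mid Z_i)$ is their (arbitrary) true covariance. Write $D_i(\theta)=D(Z_i,\theta)$, $W_i(\theta)=W(Z_i,\theta)$ and $$J(\theta)=\mathbb E[D_i(\theta)^\top W_i(\theta)D_i(\theta)],\qquad K(\theta)=\mathbb E[D_i(\theta)^\top W_i(\theta)\Sigma_iW_i(\theta)D_i(\theta)].$$ Regularity: on an open neighbourhood $U$ of $\theta_0$, $\mu(z,\cdot)$ is $C^2$ and $W(z,\cdot)$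 is $C^1$ for every $z$, both are measurable in $z$, and $\|\partial_\theta s(z,y,\theta)\|\le G(z,y)$ for all $\theta\in U$ and some $G$ integrable under the law of $(Z_1,Y_1)$; the expectations $J(\theta_0)$ and $K(\theta_0)$ exist. For random vectors $X_n$ and $r_n\ge 0$, say that $X_n=O_p(r_n)$ *with constants* $C(\cdot)$ if for every $\varepsilon>0$, $\Pr(\|X_n\|>C(\varepsilon)r_n)\le\varepsilon$ for all large $n$; $O_p(r_n)$ means this for some function $C$. For a finite set $\mathcal X$ of size $k$, a law $Q>0$ on $\mathcal X$, a map $h:\mathcal X\to\mathbb R^d$ and $\alpha:\mathbb R^p\to\mathbb R^d$, let $P^*_{\theta_0}$ be the minimizer of $P\mapsto\sum_xP(x)\log\{P(x)/Q(x)\}$ over the laws $P>0$ on $\mathcal X$ with $\sum_xP(x)h(x)=\alpha(\theta_0)$ (when it exists), let $\mathsf T=\{v\in\mathbb R^k:\sum_xv_x=0,\ \sum_xv_xh(x)=0\}$, and let $H^*_{\theta_0}=V^\top\operatorname{diag}(1/P^*_{\theta_0})V$, where the columns of $V$ form an orthonormal basis of $\mathsf T$. Below $\dim\mathsf T=p$,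 so that $H^*_{\theta_0}$ is $p\times p$ like $J(\theta_0)$; $\preceq$ is the Loewner order and $\lambda_{\min}$ the smallest eigenvalue. **Theorem (GEE robustness).** Suppose that $\theta_0$ solves the population estimating equation $\mathbb E[s(Z_1,Y_1,\theta_0)]=0$ and that $\lambda_{\min}(J(\theta_0))>0$. Let $\hat\theta_n$ be any consistent root, that is, random vectors with $\hat\theta_n\to\theta_0$ in probability and $\Pr\big(\sum_{i=1}^ns(Z_i,Y_i,\hat\theta_n)=0\big)\to1$. Then: 1. $$\|\hat\theta_n-\theta_0\|=O_p\Big(\sqrt{\tfrac{\log n}{n\,\lambda_{\min}(J(\theta_0))}}\Big).$$ 2. The rate is preserved up to the factor $a^{-1/2}$ under comparable metrics. Precisely, there is a function $C(\cdot)$ such that part 1 holds with constants $C(\cdot)$ and, for every $H^*_{\theta_0}$ as above and all real $a>0$ and $b$ with $aH^*_{\theta_0}\preceq J(\theta_0)\preceq bH^*_{\theta_0}$, $$\sqrt{\tfrac{\log n}{n\,\lambda_{\min}(J(\theta_0))}}\le a^{-1/2}\sqrt{\tfrac{\log n}{n\,\lambda_{\min}(H^*_{\theta_0})}}\quad\text{for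 all }n\ge1,\qquad \|\hat\theta_n-\theta_0\|=O_p\Big(a^{-1/2}\sqrt{\tfrac{\log n}{n\,\lambda_{\min}(H^*_{\theta_0})}}\Big)$$ with the same constants $C(\cdot)$. 3. The matrix $J(\theta_0)^{-1}K(\theta_0)J(\theta_0)^{-1}$ is positive semidefinite and $$\sqrt n\,(\hat\theta_n-\theta_0)\ \xrightarrow{d}\ \mathcal N\big(0,\ J(\theta_0)^{-1}K(\theta_0)J(\theta_0)^{-1}\big).$$ -/

import Mathlib

open MeasureTheory ProbabilityTheory Filter Topology
open scoped Matrix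

/-- Smallest eigenvalue of a real symmetric matrix (the least element of its real spectrum). -/
noncomputable def lambdaMin {p : ℕ} (M : Matrix (Fin p) (Fin p) ℝ) : ℝ :=
  sInf (spectrum ℝ M)

/-- `X n = O_P(r n)` with constants `C`: for every `ε > 0`, for all large `n`,
`P(‖X n‖ > C ε * r n) ≤ ε`.  The usual `X n = O_P(r n)` is `∃ C, IsBigOInProbWith C P X r`. -/
def IsBigOInProbWith {Ω E : Type*} [MeasurableSpace Ω] [NormedAddCommGroup E]
    (C : ℝ → ℝ) (P : Measure Ω) (X : ℕ → Ω → E) (r : ℕ → ℝ) : Prop :=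
  ∀ ε : ℝ, 0 < ε → ∀ᶠ n in atTop, P {ω | C ε * r n < ‖X n ω‖} ≤ ENNReal.ofReal ε

namespace GEE

section

variable {𝓩 : Type*} {m p : ℕ}

/-- The Jacobian `D(z, θ)` of the mean of a cluster with covariates `z`; entry `(j, a)` is
`∂ μ_j(z, θ) / ∂ θ_a`. -/
noncomputable def jacobian (μ : 𝓩 → EuclideanSpace ℝ (Fin p) → EuclideanSpace ℝ (Fin m))
    (z : 𝓩) (θ : EuclideanSpace ℝ (Fin p)) : Matrix (Fin m) (Fin p) ℝ :=
  Matrix.of fun j a => fderiv ℝ (μ z) θ (EuclideanSpace.single a 1) j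

/-- The contribution `D(z, θ)ᵀ W(z, θ) (y - μ(z, θ))` of a cluster `x = (z, y)` to the estimating
equation. -/
noncomputable def score (μ : 𝓩 → EuclideanSpace ℝ (Fin p) → EuclideanSpace ℝ (Fin m))
    (W : 𝓩 → EuclideanSpace ℝ (Fin p) → Matrix (Fin m) (Fin m) ℝ)
    (x : 𝓩 × EuclideanSpace ℝ (Fin m)) (θ : EuclideanSpace ℝ (Fin p)) :
    EuclideanSpace ℝ (Fin p) :=
  WithLp.toLp 2
    (((jacobian μ x.1 θ)ᵀ * W x.1 θ) *ᵥ (WithLp.ofLp (x.2 - μ x.1 θ)))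

variable [MeasurableSpace 𝓩]

/-- The conditional expectation of a function of a cluster `x = (z, y)` given its covariates `z`,
under the law `ρ` of a cluster. -/
noncomputable def condZ (ρ : Measure (𝓩 × EuclideanSpace ℝ (Fin m)))
    (f : 𝓩 × EuclideanSpace ℝ (Fin m) → ℝ) : 𝓩 × EuclideanSpace ℝ (Fin m) → ℝ :=
  ρ[f | MeasurableSpace.comap Prod.fst inferInstance]

/-- The true covariance matrix `Σ = Cov(Y | Z)` of the outcomes of a cluster given its covariates. -/
noncomputable def trueCov (ρ : Measure (𝓩 × EuclideanSpace ℝ (Fin m)))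
    (x : 𝓩 × EuclideanSpace ℝ (Fin m)) : Matrix (Fin m) (Fin m) ℝ :=
  Matrix.of fun j l =>
    condZ ρ (fun x' => (x'.2 j - condZ ρ (fun x'' => x''.2 j) x') *
      (x'.2 l - condZ ρ (fun x'' => x''.2 l) x')) x

/-- The integrand `Dᵀ W D`. -/
noncomputable def breadIntegrand
    (μ : 𝓩 → EuclideanSpace ℝ (Fin p) → EuclideanSpace ℝ (Fin m))
    (W : 𝓩 → EuclideanSpace ℝ (Fin p) → Matrix (Fin m) (Fin m) ℝ)
    (θ : EuclideanSpace ℝ (Fin p)) (x : 𝓩 × EuclideanSpace ℝ (Fin m)) :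
    Matrix (Fin p) (Fin p) ℝ :=
  (jacobian μ x.1 θ)ᵀ * W x.1 θ * jacobian μ x.1 θ

/-- The integrand `Dᵀ W Σ W D`. -/
noncomputable def meatIntegrand (ρ : Measure (𝓩 × EuclideanSpace ℝ (Fin m)))
    (μ : 𝓩 → EuclideanSpace ℝ (Fin p) → EuclideanSpace ℝ (Fin m))
    (W : 𝓩 → EuclideanSpace ℝ (Fin p) → Matrix (Fin m) (Fin m) ℝ)
    (θ : EuclideanSpace ℝ (Fin p)) (x : 𝓩 × EuclideanSpace ℝ (Fin m)) :
    Matrix (Fin p) (Fin p) ℝ :=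
  (jacobian μ x.1 θ)ᵀ * W x.1 θ * trueCov ρ x * W x.1 θ * jacobian μ x.1 θ

/-- The effective curvature `J(θ) = E[Dᵀ W D]`. -/
noncomputable def J (ρ : Measure (𝓩 × EuclideanSpace ℝ (Fin m)))
    (μ : 𝓩 → EuclideanSpace ℝ (Fin p) → EuclideanSpace ℝ (Fin m))
    (W : 𝓩 → EuclideanSpace ℝ (Fin p) → Matrix (Fin m) (Fin m) ℝ)
    (θ : EuclideanSpace ℝ (Fin p)) : Matrix (Fin p) (Fin p) ℝ :=
  Matrix.of fun a b => ∫ x, breadIntegrand μ W θ x a b ∂ρ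

/-- The Godambe sandwich middle `K(θ) = E[Dᵀ W Σ W D]`. -/
noncomputable def K (ρ : Measure (𝓩 × EuclideanSpace ℝ (Fin m)))
    (μ : 𝓩 → EuclideanSpace ℝ (Fin p) → EuclideanSpace ℝ (Fin m))
    (W : 𝓩 → EuclideanSpace ℝ (Fin p) → Matrix (Fin m) (Fin m) ℝ)
    (θ : EuclideanSpace ℝ (Fin p)) : Matrix (Fin p) (Fin p) ℝ :=
  Matrix.of fun a b => ∫ x, meatIntegrand ρ μ W θ x a b ∂ρ

/-- The model together with the standing assumptions under which the estimating equation is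
studied near `θ₀`; `ρ` is the law of one cluster `(Z, Y)`. -/
structure Regular (ρ : Measure (𝓩 × EuclideanSpace ℝ (Fin m)))
    (μ : 𝓩 → EuclideanSpace ℝ (Fin p) → EuclideanSpace ℝ (Fin m))
    (W : 𝓩 → EuclideanSpace ℝ (Fin p) → Matrix (Fin m) (Fin m) ℝ)
    (θ₀ : EuclideanSpace ℝ (Fin p)) (U : Set (EuclideanSpace ℝ (Fin p))) : Prop where
  isOpen : IsOpen U
  mem : θ₀ ∈ U
  measurable_mean : ∀ θ ∈ U, Measurable fun z => μ z θ
  measurable_weight : ∀ θ ∈ U, ∀ j l, Measurable fun z => W z θ j l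
  contDiffOn_mean : ∀ z, ContDiffOn ℝ 2 (μ z) U
  contDiffOn_weight : ∀ z j l, ContDiffOn ℝ 1 (fun θ => W z θ j l) U
  symm_weight : ∀ z, ∀ θ ∈ U, (W z θ).IsSymm
  /-- The outcomes are square integrable. -/
  memLp : MemLp (fun x : 𝓩 × EuclideanSpace ℝ (Fin m) => x.2) 2 ρ
  /-- The outcomes of a cluster have (conditional) mean `μ(z, θ₀)`. -/
  mean : ∀ j, condZ ρ (fun x => x.2 j) =ᵐ[ρ] fun x => μ x.1 θ₀ j
  /-- The expectation defining `J(θ₀)` exists. -/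
  integrable_J : ∀ a b, Integrable (fun x => breadIntegrand μ W θ₀ x a b) ρ
  /-- The expectation defining `K(θ₀)` exists. -/
  integrable_K : ∀ a b, Integrable (fun x => meatIntegrand ρ μ W θ₀ x a b) ρ
  /-- The derivative of the estimating function is dominated on `U`. -/
  dominated : ∃ G : 𝓩 × EuclideanSpace ℝ (Fin m) → ℝ, Integrable G ρ ∧
    ∀ x, ∀ θ ∈ U, ‖fderiv ℝ (score μ W x) θ‖ ≤ G x

end

end GEE

namespace InfoGeom

variable {k d : ℕ}

/-- The laws `P` in the open simplex with `E_P[h] = c`. -/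
def feasible (h : Fin k → EuclideanSpace ℝ (Fin d)) (c : EuclideanSpace ℝ (Fin d)) :
    Set (Fin k → ℝ) :=
  {P | (∀ x, 0 < P x) ∧ ∑ x, P x = 1 ∧ ∑ x, P x • h x = c}

/-- Kullback-Leibler divergence between two positive laws on a finite set. -/
noncomputable def kl (P Q : Fin k → ℝ) : ℝ :=
  ∑ x, P x * Real.log (P x / Q x)

/-- `P` is the information projection of `Q` onto the laws with `E_P[h] = c`. -/
def IsInfoProjection (Q : Fin k → ℝ) (h : Fin k → EuclideanSpace ℝ (Fin d))
    (c : EuclideanSpace ℝ (Fin d)) (P : Fin k → ℝ) : Prop :=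
  P ∈ feasible h c ∧ IsMinOn (fun P' => kl P' Q) (feasible h c) P

/-- The tangent space `{v : 1ᵀ v = 0, A v = 0}` of the constraint manifold, `A = [h(1) ... h(k)]`. -/
def tangent (h : Fin k → EuclideanSpace ℝ (Fin d)) :
    Submodule ℝ (EuclideanSpace ℝ (Fin k)) where
  carrier := {v | ∑ x, v x = 0 ∧ ∑ x, v x • h x = 0}
  add_mem' := by
    rintro v w ⟨hv, hv'⟩ ⟨hw, hw'⟩
    constructor
    · simp [Finset.sum_add_distrib, hv, hw]
    · simp [Finset.sum_add_distrib, add_smul, hv', hw']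
  zero_mem' := by simp
  smul_mem' := by
    rintro c v ⟨hv, hv'⟩
    constructor
    · simp [← Finset.mul_sum, hv]
    · simp [mul_smul, ← Finset.smul_sum, hv']

/-- The projected Hessian `H* = Vᵀ diag(1 / P*) V` in an orthonormal basis `V` of the tangent
space. -/
noncomputable def hessian {p : ℕ} {h : Fin k → EuclideanSpace ℝ (Fin d)}
    (V : OrthonormalBasis (Fin p) ℝ (tangent h)) (Pstar : Fin k → ℝ) :
    Matrix (Fin p) (Fin p) ℝ :=
  let B : Matrix (Fin k) (Fin p) ℝ := Matrix.of fun x a => (V a : EuclideanSpace ℝ (Fin k)) x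
  Bᵀ * Matrix.diagonal (fun x => (Pstar x)⁻¹) * B

end InfoGeom

/-! Write `s` for the score, `Δ = θhat n - θ₀`, and expand the estimating equation at the root
around `θ₀`. Averaged over the clusters it reads `0 = n⁻¹ ∑ sᵢ(θ₀) + (n⁻¹ ∑ ∂sᵢ(θ₀)) Δ + error`. The
mean derivative tends to `E[∂s] = -J`: the part where the derivative falls on `Dᵀ W` is linear in
the residual `Y - μ`, whose conditional mean given `Z` is zero. Since `J` is invertible, `√n Δ = J⁻¹
n^(-1/2) ∑ sᵢ(θ₀) + o_P(1)`. The central limit theorem and `E⟨s, u⟩² = uᵀ K u` then give the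
sandwich limit; misspecified weights affect only the covariance.

The error needs no second derivative of the score. By `exists_uniform_linearization`, on a small
ball it is at most `R x * ‖θ - θ₀‖` with `E[R]` arbitrarily small, and Markov's inequality handles
the mean of `R`. The resulting error is relative to `‖Δ‖`, so it is absorbed
(`norm_add_le_of_norm_add_le_mul`); this yields the `√n` rate from mere consistency.

Integrability is the other difficulty: only the sums defining `J`, `K` and the score derivative are
integrable, not their separate terms. `integral_sum_mul_condExp` and `integrable_sum_mul_of_condExp`
therefore take weights out of conditional expectations by truncation.

The two rate statements follow from `√n`-tightness: the factor `√(log n)` eventually exceeds any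
constant, so one constant serves every comparable metric, and the comparison of rates is
monotonicity of the smallest eigenvalue in the Loewner order. -/

/-! ### Smallest eigenvalues and the Loewner order. -/

section LambdaMin

variable {p : ℕ} {M N : Matrix (Fin p) (Fin p) ℝ}

theorem posSemidef_sub_smul_one_iff (hM : M.IsHermitian) (c : ℝ) :
    (M - c • (1 : Matrix (Fin p) (Fin p) ℝ)).PosSemidef ↔ ∀ e ∈ spectrum ℝ M, c ≤ e := by
  have hH : (M - c • (1 : Matrix (Fin p) (Fin p) ℝ)).IsHermitian := by
    refine hM.sub ?_
    simp [Matrix.IsHermitian]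
  rw [Matrix.posSemidef_iff_isHermitian_and_spectrum_nonneg, and_iff_right hH,
    ← Algebra.algebraMap_eq_smul_one, ← spectrum.sub_singleton_eq, Set.sub_singleton]
  simp [Set.subset_def]

theorem posSemidef_sub_lambdaMin (hM : M.IsHermitian) :
    (M - lambdaMin M • (1 : Matrix (Fin p) (Fin p) ℝ)).PosSemidef :=
  (posSemidef_sub_smul_one_iff hM _).2 fun _ he => csInf_le (Matrix.finite_spectrum M).bddBelow he

theorem spectrum_nonempty_of_isHermitian (hp : 0 < p) (hM : M.IsHermitian) :
    (spectrum ℝ M).Nonempty := by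
  rw [hM.spectrum_real_eq_range_eigenvalues]
  exact ⟨_, ⟨0, hp⟩, rfl⟩

theorem le_lambdaMin (hp : 0 < p) (hM : M.IsHermitian) {c : ℝ}
    (h : (M - c • (1 : Matrix (Fin p) (Fin p) ℝ)).PosSemidef) : c ≤ lambdaMin M :=
  le_csInf (spectrum_nonempty_of_isHermitian hp hM) ((posSemidef_sub_smul_one_iff hM c).1 h)

/-- In dimension zero the spectrum is empty and `sInf ∅ = 0`, so a positive value excludes this
case. -/
theorem pos_of_lambdaMin_pos (h : 0 < lambdaMin M) : 0 < p := by
  rcases Nat.eq_zero_or_pos p with rfl | hp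
  · simp [lambdaMin, spectrum.of_subsingleton] at h
  · exact hp

theorem posDef_of_lambdaMin_pos (hM : M.IsHermitian) (h : 0 < lambdaMin M) : M.PosDef := by
  have h1 : (lambdaMin M • (1 : Matrix (Fin p) (Fin p) ℝ)).PosDef := Matrix.PosDef.one.smul h
  simpa using h1.posSemidef_add (posSemidef_sub_lambdaMin hM)

theorem Matrix.PosDef.lambdaMin_pos (hp : 0 < p) (hM : M.PosDef) : 0 < lambdaMin M := by
  have hfin := Matrix.finite_spectrum M
  have hmem := (spectrum_nonempty_of_isHermitian hp hM.1).csInf_mem hfin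
  rw [hM.1.spectrum_real_eq_range_eigenvalues] at hmem
  obtain ⟨i, hi⟩ := hmem
  have := hM.eigenvalues_pos i
  rw [hi, ← hM.1.spectrum_real_eq_range_eigenvalues] at this
  exact this

/-- Monotonicity of the smallest eigenvalue in the Loewner order. -/
theorem mul_lambdaMin_le (hp : 0 < p) (hM : M.IsHermitian) (hN : N.IsHermitian) {a : ℝ}
    (ha : 0 ≤ a) (h : (M - a • N).PosSemidef) : a * lambdaMin N ≤ lambdaMin M := by
  refine le_lambdaMin hp hM ?_
  have h1 := h.add ((posSemidef_sub_lambdaMin hN).smul ha)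
  convert h1 using 1
  rw [smul_sub, smul_smul]
  abel

/-- The diagonal matrix is positive definite because the law is positive, and congruence by `B`
keeps this because linear independence of the basis makes `B` injective. -/
theorem InfoGeom.hessian_posDef {k d : ℕ} {h : Fin k → EuclideanSpace ℝ (Fin d)}
    (V : OrthonormalBasis (Fin p) ℝ (InfoGeom.tangent h)) {Q : Fin k → ℝ} (hQ : ∀ x, 0 < Q x) :
    (InfoGeom.hessian V Q).PosDef := by
  have hD : (Matrix.diagonal fun x => (Q x)⁻¹).PosDef :=
    Matrix.PosDef.diagonal fun x => inv_pos.2 (hQ x)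
  unfold InfoGeom.hessian
  refine hD.conjTranspose_mul_mul_same ?_
  intro v w hvw
  have key : ∑ a, v a • V a = ∑ a, w a • V a := by
    ext x
    have := congrFun hvw x
    simpa [Matrix.mulVec, dotProduct, mul_comm] using this
  have hli := V.toBasis.linearIndependent
  rw [linearIndependent_iff_injective_fintypeLinearCombination] at hli
  exact hli (by simpa [Fintype.linearCombination_apply] using key)

end LambdaMin

/-! ### The multivariate central limit theorem and tightness. -/

section CLT

variable {Ω : Type*} [MeasurableSpace Ω] {P : Measure Ω} {p : ℕ}

/-- The Cramér–Wold device: it reduces the vector limit theorem to real projections. -/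
theorem charFun_map_eq_charFun_map_inner {E : Type*} [NormedAddCommGroup E] [InnerProductSpace ℝ E]
    [MeasurableSpace E] [BorelSpace E] [SecondCountableTopology E] {X : Ω → E}
    (hX : AEMeasurable X P) (t : E) :
    charFun (P.map X) t = charFun (P.map fun ω => inner ℝ (X ω) t) 1 := by
  rw [charFun_apply, charFun_apply, integral_map hX (by fun_prop),
    integral_map (by fun_prop) (by fun_prop)]
  simp

variable [IsProbabilityMeasure P]

theorem tendsto_charFun_inv_sqrt_mul_sum {X : ℕ → Ω → ℝ} (hX : MemLp (X 0) 2 P)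
    (hmean : P[X 0] = 0) (hindep : iIndepFun X P)
    (hident : ∀ i, IdentDistrib (X i) (X 0) P P) :
    Tendsto (fun n : ℕ => charFun (P.map fun ω => (√(n : ℝ))⁻¹ * ∑ k ∈ Finset.range n, X k ω) 1)
      atTop (𝓝 (Complex.exp (-((∫ ω, X 0 ω ^ 2 ∂P : ℝ) : ℂ) / 2))) := by
  have hY : HasLaw id (gaussianReal 0 Var[X 0; P].toNNReal)
      (gaussianReal 0 Var[X 0; P].toNNReal) := HasLaw.id
  have h := ProbabilityMeasure.tendsto_iff_tendsto_charFun.1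
    (tendstoInDistribution_inv_sqrt_mul_sum_sub hY hX hindep hident).tendsto 1
  have hvar : Var[X 0; P] = ∫ ω, X 0 ω ^ 2 ∂P :=
    variance_of_integral_eq_zero hX.aestronglyMeasurable.aemeasurable hmean
  have hnn : 0 ≤ ∫ ω, X 0 ω ^ 2 ∂P := integral_nonneg fun ω => sq_nonneg _
  simpa [hmean, charFun_gaussianReal, hvar, neg_div, max_eq_left hnn] using h

/-- The multivariate central limit theorem for centred i.i.d. vectors. -/
theorem tendstoInDistribution_multivariateGaussian {ξ : ℕ → Ω → EuclideanSpace ℝ (Fin p)}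
    {S : Matrix (Fin p) (Fin p) ℝ} (hS : S.PosSemidef) (hL2 : MemLp (ξ 0) 2 P)
    (hmean : P[ξ 0] = 0)
    (hcov : ∀ t : EuclideanSpace ℝ (Fin p), ∫ ω, inner ℝ (ξ 0 ω) t ^ 2 ∂P = t ⬝ᵥ S *ᵥ t)
    (hindep : iIndepFun ξ P) (hident : ∀ i, IdentDistrib (ξ i) (ξ 0) P P) :
    TendstoInDistribution (fun (n : ℕ) ω => (√(n : ℝ))⁻¹ • ∑ k ∈ Finset.range n, ξ k ω) atTop id
      (fun _ => P) (multivariateGaussian 0 S) := by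
  have hm i : AEMeasurable (ξ i) P := (hident i).aemeasurable_fst
  have hmT (n : ℕ) : AEMeasurable (fun ω => (√(n : ℝ))⁻¹ • ∑ k ∈ Finset.range n, ξ k ω) P :=
    (Finset.aemeasurable_fun_sum (Finset.range n) fun i _ => hm i).const_smul (√(n : ℝ))⁻¹
  refine ⟨hmT, aemeasurable_id, ProbabilityMeasure.tendsto_iff_tendsto_charFun.2 fun t => ?_⟩
  have h := tendsto_charFun_inv_sqrt_mul_sum (P := P) (X := fun i ω => inner ℝ (ξ i ω) t)
    (hL2.inner_const t)
    (by
      have := integral_inner (𝕜 := ℝ) (hL2.integrable (by norm_num)) t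
      simp only [real_inner_comm] at this ⊢
      rw [this, hmean, inner_zero_right])
    (hindep.comp (fun _ x => inner ℝ x t) (by fun_prop))
    (fun i => (hident i).comp (u := fun x => inner ℝ x t) (by fun_prop))
  rw [hcov] at h
  simp only [ProbabilityMeasure.coe_mk, Measure.map_id, charFun_multivariateGaussian hS]
  refine (h.congr fun n => ?_).trans (by simp [neg_div])
  rw [charFun_map_eq_charFun_map_inner (hmT n)]
  simp [inner_smul_left, sum_inner]

/-- A sequence that converges in distribution is bounded in probability. -/
theorem MeasureTheory.TendstoInDistribution.exists_measure_le_norm_le {E Ω' : Type*}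
    [MeasurableSpace Ω'] {P' : Measure Ω'} [IsProbabilityMeasure P']
    [NormedAddCommGroup E] [InnerProductSpace ℝ E] [FiniteDimensional ℝ E] [MeasurableSpace E]
    [BorelSpace E] {T : ℕ → Ω → E} {Z : Ω' → E}
    (h : TendstoInDistribution T atTop Z (fun _ => P) P') {ε : ENNReal} (hε : 0 < ε) :
    ∃ M : ℝ, 0 < M ∧ ∀ n, P {ω | M ≤ ‖T n ω‖} ≤ ε := by
  have hprob (n : ℕ) : IsProbabilityMeasure (P.map (T n)) :=
    Measure.isProbabilityMeasure_map (h.forall_aemeasurable n)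
  have hprob' : IsProbabilityMeasure (P'.map Z) := Measure.isProbabilityMeasure_map h.aemeasurable_limit
  -- Pointwise convergence of characteristic functions to a limit continuous at zero forces
  -- tightness.
  have ht : IsTightMeasureSet (Set.range fun n => P.map (T n)) :=
    isTightMeasureSet_of_tendsto_charFun (f := charFun (P'.map Z)) (by fun_prop)
      (ProbabilityMeasure.tendsto_iff_tendsto_charFun.1 h.tendsto)
  have h1 := tendsto_measure_norm_gt_of_isTightMeasureSet ht
  obtain ⟨r, hr, hr0⟩ := ((ENNReal.tendsto_nhds_zero.1 h1 ε hε).and (eventually_gt_atTop 0)).exists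
  refine ⟨r + 1, by positivity, fun n => le_trans ?_ hr⟩
  rw [iSup_range]
  refine le_trans ?_ (le_iSup _ n)
  rw [Measure.map_apply_of_aemeasurable (h.forall_aemeasurable n)
    (measurableSet_lt measurable_const measurable_norm)]
  refine measure_mono fun ω hω => ?_
  simp only [Set.mem_ofPred_eq, Set.mem_preimage] at hω ⊢
  linarith

end CLT

/-! ### Measurability of derivatives in a parameter. -/

section MeasurableDerivative

variable {𝓧 E F : Type*} [MeasurableSpace 𝓧] [NormedAddCommGroup E] [NormedSpace ℝ E]
  [NormedAddCommGroup F] [NormedSpace ℝ F] [MeasurableSpace F] [BorelSpace F]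
  [SecondCountableTopology F]

/-- The directional derivative of a function measurable in a parameter is measurable in it. -/
theorem measurable_fderiv_param_apply {f : 𝓧 → E → F} {U : Set E} (hU : IsOpen U) {θ : E}
    (hθ : θ ∈ U) (hm : ∀ θ ∈ U, Measurable fun x => f x θ)
    (hd : ∀ x, DifferentiableAt ℝ (f x) θ) (v : E) :
    Measurable fun x => fderiv ℝ (f x) θ v := by
  have hlim : Tendsto (fun n : ℕ => θ + ((n : ℝ))⁻¹ • v) atTop (𝓝 θ) := by
    have h1 := (tendsto_inv_atTop_nhds_zero_nat (𝕜 := ℝ)).smul_const v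
    simpa using h1.const_add θ
  -- The derivative is a limit of difference quotients with step `1 / n`; skipping the first `N`
  -- indices keeps every evaluation point in `U`, where measurability is known.
  obtain ⟨N, hN⟩ := eventually_atTop.1 (hlim.eventually_mem (hU.mem_nhds hθ))
  refine measurable_of_tendsto_metrizable
    (f := fun (n : ℕ) x => ((n + N : ℕ) : ℝ) • (f x (θ + (((n + N : ℕ) : ℝ))⁻¹ • v) - f x θ))
    (fun n => ((hm _ (hN _ (Nat.le_add_left _ _))).sub (hm θ hθ)).const_smul _)
    (tendsto_pi_nhds.2 fun x => ?_)
  exact (hd x).hasFDerivAt.lim_real v |>.comp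
    (tendsto_natCast_atTop_atTop.comp (tendsto_add_atTop_nat N))

/-- In finite dimension the derivative is a finite sum of rank-one maps built continuously from the
partial derivatives. -/
theorem stronglyMeasurable_fderiv_param {p : ℕ} {f : 𝓧 → EuclideanSpace ℝ (Fin p) → F}
    {U : Set (EuclideanSpace ℝ (Fin p))} (hU : IsOpen U) {θ : EuclideanSpace ℝ (Fin p)}
    (hθ : θ ∈ U) (hm : ∀ θ ∈ U, Measurable fun x => f x θ)
    (hd : ∀ x, DifferentiableAt ℝ (f x) θ) :
    StronglyMeasurable fun x => fderiv ℝ (f x) θ := by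
  have h (x : 𝓧) : fderiv ℝ (f x) θ = ∑ b, ContinuousLinearMap.smulRightL ℝ
      (EuclideanSpace ℝ (Fin p)) F (EuclideanSpace.proj b)
      (fderiv ℝ (f x) θ (EuclideanSpace.single b 1)) := by
    refine ContinuousLinearMap.coe_injective
      ((EuclideanSpace.basisFun (Fin p) ℝ).toBasis.ext fun c => ?_)
    simp
  rw [funext h]
  refine Finset.stronglyMeasurable_fun_sum _ fun b _ => ?_
  exact (ContinuousLinearMap.continuous _).comp_stronglyMeasurable
    (measurable_fderiv_param_apply hU hθ hm hd _).stronglyMeasurable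

end MeasurableDerivative

/-! ### Linearization with a uniformly small integrable error. -/

section LinearizationError

variable {E F : Type*} [NormedAddCommGroup E] [NormedSpace ℝ E] [NormedAddCommGroup F]
  [NormedSpace ℝ F]

/-- The relative error at `θ` of the linearization of `f` at `θ₀`. -/
noncomputable def linearizationError (f : E → F) (θ₀ θ : E) : ℝ :=
  ‖f θ - f θ₀ - fderiv ℝ f θ₀ (θ - θ₀)‖ / ‖θ - θ₀‖

theorem norm_sub_sub_le_of_linearizationError_le {f : E → F} {θ₀ θ : E} {c : ℝ}
    (h : linearizationError f θ₀ θ ≤ c) :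
    ‖f θ - f θ₀ - fderiv ℝ f θ₀ (θ - θ₀)‖ ≤ c * ‖θ - θ₀‖ := by
  -- At `θ = θ₀` the quotient is `0 / 0 = 0`, and the bound is trivial there.
  rcases eq_or_ne θ θ₀ with rfl | hne
  · simp
  · exact (div_le_iff₀ (norm_pos_iff.2 (sub_ne_zero.2 hne))).1 h

theorem linearizationError_le {f : E → F} {θ₀ θ : E} {c : ℝ} (hc : 0 ≤ c)
    (h : ‖f θ - f θ₀ - fderiv ℝ f θ₀ (θ - θ₀)‖ ≤ c * ‖θ - θ₀‖) :
    linearizationError f θ₀ θ ≤ c :=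
  div_le_of_le_mul₀ (norm_nonneg _) hc h

/-- Mean value inequality for `f` minus its linear part at `θ₀`, whose derivative has norm at most
`G + G`. -/
theorem linearizationError_le_of_norm_fderiv_le {f : E → F} {θ₀ : E} {δ G : ℝ}
    (hd : ∀ θ ∈ Metric.ball θ₀ δ, DifferentiableAt ℝ f θ)
    (hG : ∀ θ ∈ Metric.ball θ₀ δ, ‖fderiv ℝ f θ‖ ≤ G) {θ : E} (hθ : θ ∈ Metric.ball θ₀ δ) :
    linearizationError f θ₀ θ ≤ 2 * G := by
  have h0 : θ₀ ∈ Metric.ball θ₀ δ := Metric.mem_ball_self (dist_nonneg.trans_lt hθ)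
  have hG0 : 0 ≤ G := (norm_nonneg _).trans (hG θ₀ h0)
  refine linearizationError_le (by positivity) ?_
  refine (convex_ball θ₀ δ).norm_image_sub_le_of_norm_fderiv_le' hd (fun x hx => ?_) h0 hθ
  linarith [norm_sub_le (fderiv ℝ f x) (fderiv ℝ f θ₀), hG x hx, hG θ₀ h0]

variable [TopologicalSpace.SeparableSpace E]

/-- The supremum of the linearization error over a countable dense subset of a ball. -/
noncomputable def linearizationModulus (f : E → F) (θ₀ : E) (δ : ℝ) : ENNReal :=
  ⨆ i : ℕ, (Metric.ball θ₀ δ).indicator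
    (fun θ => ENNReal.ofReal (linearizationError f θ₀ θ)) (TopologicalSpace.denseSeq E i)

theorem linearizationModulus_le {f : E → F} {θ₀ : E} {δ c : ℝ}
    (h : ∀ θ ∈ Metric.ball θ₀ δ, linearizationError f θ₀ θ ≤ c) :
    linearizationModulus f θ₀ δ ≤ ENNReal.ofReal c := by
  refine iSup_le fun i => ?_
  by_cases hi : TopologicalSpace.denseSeq E i ∈ Metric.ball θ₀ δ
  · simpa [hi] using ENNReal.ofReal_le_ofReal (h _ hi)
  · simp [hi]

/-- Both sides are continuous in `θ`, so the bound passes from the dense points to the whole ball.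
The countable supremum is used because it is measurable in a parameter. -/
theorem norm_sub_sub_le_linearizationModulus {f : E → F} {θ₀ θ : E} {δ : ℝ}
    (hc : ContinuousOn f (Metric.ball θ₀ δ)) (hfin : linearizationModulus f θ₀ δ ≠ ⊤)
    (hθ : θ ∈ Metric.ball θ₀ δ) :
    ‖f θ - f θ₀ - fderiv ℝ f θ₀ (θ - θ₀)‖ ≤ (linearizationModulus f θ₀ δ).toReal * ‖θ - θ₀‖ := by
  have hcl := (TopologicalSpace.denseRange_denseSeq E).open_subset_closure_inter
    (Metric.isOpen_ball (x := θ₀) (ε := δ)) hθ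
  obtain ⟨u, hu, hlim⟩ := mem_closure_iff_seq_limit.1 hcl
  have hfu : Tendsto (fun n => f (u n)) atTop (𝓝 (f θ)) :=
    ((hc θ hθ).continuousAt (Metric.isOpen_ball.mem_nhds hθ)).tendsto.comp hlim
  have hsub := hlim.sub_const θ₀
  have hL := ((fderiv ℝ f θ₀).continuous.tendsto _).comp hsub
  refine le_of_tendsto_of_tendsto' ((hfu.sub_const (f θ₀)).sub hL).norm (hsub.norm.const_mul _)
    fun n => ?_
  obtain ⟨hb, i, hi⟩ := hu n
  refine norm_sub_sub_le_of_linearizationError_le ?_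
  rw [← ENNReal.ofReal_le_iff_le_toReal hfin]
  refine le_trans ?_ (le_iSup _ i)
  rw [hi, Set.indicator_of_mem hb]

theorem tendsto_linearizationModulus {f : E → F} {θ₀ : E} (hf : DifferentiableAt ℝ f θ₀)
    {δ : ℕ → ℝ} (hδ : Tendsto δ atTop (𝓝 0)) :
    Tendsto (fun k => linearizationModulus f θ₀ (δ k)) atTop (𝓝 0) := by
  refine ENNReal.tendsto_nhds_zero.2 fun ε hε => ?_
  obtain ⟨c, hc0, hcε⟩ := ENNReal.lt_iff_exists_real_btwn.1 hε
  have hcpos : 0 < c := ENNReal.ofReal_pos.1 hcε.1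
  have h := (hasFDerivAt_iff_isLittleO.1 hf.hasFDerivAt).def hcpos
  obtain ⟨r, hr, hball⟩ := Metric.eventually_nhds_iff_ball.1 h
  filter_upwards [hδ.eventually_lt_const hr] with k hk
  refine (linearizationModulus_le fun θ hθ => ?_).trans hcε.2.le
  exact linearizationError_le hc0 (hball θ (Metric.ball_subset_ball hk.le hθ))

end LinearizationError

section UniformLinearization

variable {𝓧 : Type*} [MeasurableSpace 𝓧] {ρ : Measure 𝓧} {p : ℕ} {F : Type*}
  [NormedAddCommGroup F] [NormedSpace ℝ F] [MeasurableSpace F] [BorelSpace F]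
  [SecondCountableTopology F]

/-- As the radius shrinks, the modulus tends to zero for each `x` by differentiability at `θ₀`, and
it is dominated by `2 * G x`. Dominated convergence makes its integral small at some radius, and `R`
is the modulus there. -/
theorem exists_uniform_linearization {s : 𝓧 → EuclideanSpace ℝ (Fin p) → F}
    {U : Set (EuclideanSpace ℝ (Fin p))} {θ₀ : EuclideanSpace ℝ (Fin p)} (hU : IsOpen U)
    (hθ₀ : θ₀ ∈ U) (hm : ∀ θ ∈ U, Measurable fun x => s x θ)
    (hd : ∀ x, DifferentiableOn ℝ (s x) U) {G : 𝓧 → ℝ} (hG : Integrable G ρ)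
    (hGs : ∀ x, ∀ θ ∈ U, ‖fderiv ℝ (s x) θ‖ ≤ G x) {ε : ℝ} (hε : 0 < ε) :
    ∃ δ > 0, ∃ R : 𝓧 → ℝ, Measurable R ∧ Integrable R ρ ∧ (∀ x, 0 ≤ R x) ∧ ∫ x, R x ∂ρ ≤ ε ∧
      ∀ x, ∀ θ ∈ Metric.ball θ₀ δ,
        ‖s x θ - s x θ₀ - fderiv ℝ (s x) θ₀ (θ - θ₀)‖ ≤ R x * ‖θ - θ₀‖ := by
  obtain ⟨r, hr, hrU⟩ := Metric.isOpen_iff.1 hU θ₀ hθ₀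
  have hdA x θ (hθ : θ ∈ U) : DifferentiableAt ℝ (s x) θ := (hd x).differentiableAt (hU.mem_nhds hθ)
  set δ : ℕ → ℝ := fun k => r / (k + 1) with hδ
  have hδpos k : 0 < δ k := by positivity
  have hδr k : Metric.ball θ₀ (δ k) ⊆ U :=
    (Metric.ball_subset_ball (div_le_self hr.le (by simp))).trans hrU
  have hδ0 : Tendsto δ atTop (𝓝 0) := by
    simpa [hδ, div_eq_mul_inv] using (tendsto_one_div_add_atTop_nhds_zero_nat (𝕜 := ℝ)).const_mul r
  have hmeas k : Measurable fun x => linearizationModulus (s x) θ₀ (δ k) := by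
    refine Measurable.iSup fun i => ?_
    by_cases hi : TopologicalSpace.denseSeq (EuclideanSpace ℝ (Fin p)) i ∈ Metric.ball θ₀ (δ k)
    · simp only [hi, Set.indicator_of_mem]
      refine ENNReal.measurable_ofReal.comp ?_
      unfold linearizationError
      exact ((((hm _ (hδr k hi)).sub (hm _ hθ₀)).sub
        (measurable_fderiv_param_apply hU hθ₀ hm (fun x => hdA x _ hθ₀) _)).norm).div_const _
    · simp [hi]
  have hbd k x : linearizationModulus (s x) θ₀ (δ k) ≤ ENNReal.ofReal (2 * G x) :=
    linearizationModulus_le fun θ hθ => linearizationError_le_of_norm_fderiv_le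
      (fun θ hθ => hdA x θ (hδr k hθ)) (fun θ hθ => hGs x θ (hδr k hθ)) hθ
  have hGfin : ∫⁻ x, ENNReal.ofReal (2 * G x) ∂ρ ≠ ⊤ := (hG.const_mul 2).lintegral_lt_top.ne
  have hlim := tendsto_lintegral_of_dominated_convergence (μ := ρ)
    (fun x => ENNReal.ofReal (2 * G x)) hmeas (fun k => ae_of_all _ (hbd k)) hGfin
    (ae_of_all _ fun x => tendsto_linearizationModulus (hdA x θ₀ hθ₀) hδ0)
  rw [lintegral_zero] at hlim
  obtain ⟨k, hk⟩ := (ENNReal.tendsto_nhds_zero.1 hlim _ (ENNReal.ofReal_pos.2 hε)).exists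
  have hfin x : linearizationModulus (s x) θ₀ (δ k) ≠ ⊤ :=
    ((hbd k x).trans_lt ENNReal.ofReal_lt_top).ne
  refine ⟨δ k, hδpos k, fun x => (linearizationModulus (s x) θ₀ (δ k)).toReal,
    (hmeas k).ennreal_toReal, integrable_toReal_of_lintegral_ne_top (hmeas k).aemeasurable
      (hk.trans_lt ENNReal.ofReal_lt_top).ne, fun x => ENNReal.toReal_nonneg, ?_, fun x θ hθ =>
    norm_sub_sub_le_linearizationModulus
      (fun θ hθ => (hdA x θ (hδr k hθ)).continuousAt.continuousWithinAt) (hfin x) hθ⟩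
  rw [integral_toReal (hmeas k).aemeasurable (ae_of_all _ fun x => (hfin x).lt_top)]
  exact ENNReal.toReal_le_of_le_ofReal hε.le hk

end UniformLinearization

/-! ### Taking weights out of conditional expectations by truncation. -/

section PullOut

variable {𝓧 ι : Type*} {m₀ m₁ : MeasurableSpace 𝓧} {ρ : Measure[m₁] 𝓧} [Fintype ι]

/-- The sets on which a finite family of functions is bounded by `N`. -/
def boundedSet (w : ι → 𝓧 → ℝ) (N : ℕ) : Set 𝓧 := {x | ∀ i, |w i x| ≤ N}

theorem measurableSet_boundedSet {w : ι → 𝓧 → ℝ} (hw : ∀ i, Measurable[m₀] (w i)) (N : ℕ) :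
    MeasurableSet[m₀] (boundedSet w N) := by
  have : boundedSet w N = ⋂ i, (w i) ⁻¹' (Set.Icc (-N) N) := by
    ext x; simp [boundedSet, abs_le]
  rw [this]
  exact MeasurableSet.iInter fun i => hw i measurableSet_Icc

theorem aecover_boundedSet {w : ι → 𝓧 → ℝ} (hw : ∀ i, Measurable[m₁] (w i)) :
    AECover ρ atTop (boundedSet w) where
  ae_eventually_mem := ae_of_all _ fun x => by
    have : ∀ i, ∀ᶠ N : ℕ in atTop, |w i x| ≤ N := fun i =>
      tendsto_natCast_atTop_atTop.eventually_ge_atTop _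
    exact eventually_all.2 this
  measurableSet := measurableSet_boundedSet hw

theorem integrableOn_boundedSet_sum_mul {w : ι → 𝓧 → ℝ} (hw : ∀ i, Measurable[m₁] (w i))
    {g : ι → 𝓧 → ℝ} (hg : ∀ i, Integrable (g i) ρ) (N : ℕ) :
    IntegrableOn (fun x => ∑ i, w i x * g i x) (boundedSet w N) ρ := by
  refine integrable_finsetSum _ fun i _ => ?_
  refine (hg i).integrableOn.bdd_mul (c := N) (hw i).aestronglyMeasurable ?_
  exact (ae_restrict_iff' (measurableSet_boundedSet hw N)).2 (ae_of_all _ fun x hx => hx i)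

variable [IsProbabilityMeasure ρ]

/-- The truncation set belongs to `m₀` and bounds every weight by `N`, so each term is integrable on
it and the bounded pull-out rule applies term by term. -/
theorem setIntegral_boundedSet_sum_mul_condExp (hm : m₀ ≤ m₁) {w : ι → 𝓧 → ℝ}
    (hw : ∀ i, Measurable[m₀] (w i)) {g : ι → 𝓧 → ℝ} (hg : ∀ i, Integrable (g i) ρ) (N : ℕ) :
    ∫ x in boundedSet w N, ∑ i, w i x * g i x ∂ρ =
      ∫ x in boundedSet w N, ∑ i, w i x * (ρ[g i | m₀]) x ∂ρ := by
  have hw' i : Measurable[m₁] (w i) := (hw i).mono hm le_rfl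
  have hT := measurableSet_boundedSet hw N
  have hT' := hm _ hT
  have hbdd (i : ι) : ∀ᵐ x ∂ρ.restrict (boundedSet w N), ‖w i x‖ ≤ N :=
    (ae_restrict_iff' hT').2 (ae_of_all _ fun x hx => hx i)
  rw [integral_finsetSum _ fun i _ =>
      (hg i).integrableOn.bdd_mul (hw' i).aestronglyMeasurable (hbdd i),
    integral_finsetSum _ fun i _ =>
      (integrable_condExp (f := g i) (m := m₀) (μ := ρ)).integrableOn.bdd_mul
        (hw' i).aestronglyMeasurable (hbdd i)]
  refine Finset.sum_congr rfl fun i _ => ?_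
  set u : 𝓧 → ℝ := (boundedSet w N).indicator (w i) with hu
  have hum : StronglyMeasurable[m₀] u := ((hw i).stronglyMeasurable).indicator hT
  have hub : ∀ᵐ x ∂ρ, ‖u x‖ ≤ N := ae_of_all _ fun x => by
    by_cases hx : x ∈ boundedSet w N
    · simpa [hu, hx] using hx i
    · simp [hu, hx]
  have hpull := condExp_stronglyMeasurable_mul_of_bound hm hum (hg i) N hub
  have hind (f : 𝓧 → ℝ) : ∫ x in boundedSet w N, w i x * f x ∂ρ = ∫ x, u x * f x ∂ρ := by
    rw [← integral_indicator hT']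
    congr with x
    by_cases hx : x ∈ boundedSet w N <;> simp [hu, hx]
  rw [hind, hind]
  calc ∫ x, u x * g i x ∂ρ = ∫ x, (ρ[u * g i | m₀]) x ∂ρ := (integral_condExp hm).symm
    _ = ∫ x, u x * (ρ[g i | m₀]) x ∂ρ := integral_congr_ae hpull

/-- `E[∑ w g] = E[∑ w E[g | m₀]]` when both sums, but not necessarily their terms, are integrable. -/
theorem integral_sum_mul_condExp (hm : m₀ ≤ m₁) {w : ι → 𝓧 → ℝ}
    (hw : ∀ i, Measurable[m₀] (w i)) {g : ι → 𝓧 → ℝ} (hg : ∀ i, Integrable (g i) ρ)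
    (h1 : Integrable (fun x => ∑ i, w i x * g i x) ρ)
    (h2 : Integrable (fun x => ∑ i, w i x * (ρ[g i | m₀]) x) ρ) :
    ∫ x, ∑ i, w i x * g i x ∂ρ = ∫ x, ∑ i, w i x * (ρ[g i | m₀]) x ∂ρ := by
  have hw' i : Measurable[m₁] (w i) := (hw i).mono hm le_rfl
  have hc := aecover_boundedSet (ρ := ρ) hw'
  refine hc.integral_eq_of_tendsto _ h1 ?_
  simp only [setIntegral_boundedSet_sum_mul_condExp hm hw hg]
  exact hc.integral_tendsto_of_countably_generated h2

/-- For a nonnegative sum, convergence of the truncated integrals already implies integrability.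
This is how existence of `K` yields a square-integrable score. -/
theorem integrable_sum_mul_of_condExp (hm : m₀ ≤ m₁) {w : ι → 𝓧 → ℝ}
    (hw : ∀ i, Measurable[m₀] (w i)) {g : ι → 𝓧 → ℝ} (hg : ∀ i, Integrable (g i) ρ)
    (hnn : ∀ x, 0 ≤ ∑ i, w i x * g i x)
    (h2 : Integrable (fun x => ∑ i, w i x * (ρ[g i | m₀]) x) ρ) :
    Integrable (fun x => ∑ i, w i x * g i x) ρ := by
  have hw' i : Measurable[m₁] (w i) := (hw i).mono hm le_rfl
  have hc := aecover_boundedSet (ρ := ρ) hw'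
  refine hc.integrable_of_integral_tendsto_of_nonneg_ae
    (∫ x, ∑ i, w i x * (ρ[g i | m₀]) x ∂ρ) (integrableOn_boundedSet_sum_mul hw' hg)
    (ae_of_all _ hnn) ?_
  simp only [setIntegral_boundedSet_sum_mul_condExp hm hw hg]
  exact hc.integral_tendsto_of_countably_generated h2

end PullOut

/-! ### Asymptotic linearity of consistent roots. -/

section ZEstimator

variable {Ω 𝓧 : Type*} [MeasurableSpace Ω] [MeasurableSpace 𝓧] {P : Measure Ω}
  {ρ : Measure 𝓧} {X : ℕ → Ω → 𝓧}

theorem integral_comp_hasLaw {E : Type*} [NormedAddCommGroup E] [NormedSpace ℝ E] {Y : Ω → 𝓧}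
    (hY : HasLaw Y ρ P) {f : 𝓧 → E} (hf : AEStronglyMeasurable f ρ) :
    ∫ ω, f (Y ω) ∂P = ∫ x, f x ∂ρ := by
  rw [← hY.map_eq] at hf ⊢
  exact (integral_map hY.aemeasurable hf).symm

theorem integrable_comp_hasLaw {E : Type*} [NormedAddCommGroup E] {Y : Ω → 𝓧}
    (hY : HasLaw Y ρ P) {f : 𝓧 → E} (hf : Integrable f ρ) : Integrable (fun ω => f (Y ω)) P := by
  rw [← hY.map_eq] at hf
  exact hf.comp_aemeasurable hY.aemeasurable

theorem identDistrib_comp_hasLaw {F : Type*} [MeasurableSpace F] (hlaw : ∀ i, HasLaw (X i) ρ P)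
    {f : 𝓧 → F} (hf : Measurable f) (i : ℕ) :
    IdentDistrib (fun ω => f (X i ω)) (fun ω => f (X 0 ω)) P P :=
  IdentDistrib.comp ⟨(hlaw i).aemeasurable, (hlaw 0).aemeasurable,
    (hlaw i).map_eq.trans (hlaw 0).map_eq.symm⟩ hf

/-- Markov's inequality for an empirical mean. -/
theorem measureReal_le_empirical_mean (hlaw : ∀ i, HasLaw (X i) ρ P) {R : 𝓧 → ℝ}
    (hR : Integrable R ρ) (hR0 : ∀ x, 0 ≤ R x) {τ η : ℝ} (hτ : 0 < τ)
    (hint : ∫ x, R x ∂ρ ≤ τ * η) {n : ℕ} (hn : n ≠ 0) :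
    P.real {ω | τ ≤ (n : ℝ)⁻¹ * ∑ i ∈ Finset.range n, R (X i ω)} ≤ η := by
  have hn' : (n : ℝ) ≠ 0 := Nat.cast_ne_zero.2 hn
  have h := mul_meas_ge_le_integral_of_nonneg (μ := P)
    (f := fun ω => (n : ℝ)⁻¹ * ∑ i ∈ Finset.range n, R (X i ω))
    (ae_of_all _ fun ω => mul_nonneg (by positivity) (Finset.sum_nonneg fun i _ => hR0 _))
    ((integrable_finsetSum _ fun i _ => integrable_comp_hasLaw (hlaw i) hR).const_mul _) τ
  rw [integral_const_mul, integral_finsetSum _ fun i _ => integrable_comp_hasLaw (hlaw i) hR] at h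
  simp only [integral_comp_hasLaw (hlaw _) hR.aestronglyMeasurable, Finset.sum_const,
    Finset.card_range, nsmul_eq_mul, inv_mul_cancel_left₀ hn'] at h
  exact le_of_mul_le_mul_left (h.trans hint) hτ

/-- As `κ ≤ 1 / 2`, the hypothesis forces `‖u‖ ≤ 2 * ‖v‖`, so an error relative to the unknown `u`
becomes one relative to the known `v`. -/
theorem norm_add_le_of_norm_add_le_mul {E : Type*} [NormedAddCommGroup E] {u v : E} {κ : ℝ}
    (h0 : 0 ≤ κ) (hκ : κ ≤ 1 / 2) (h : ‖u + v‖ ≤ κ * ‖u‖) : ‖u + v‖ ≤ 2 * κ * ‖v‖ := by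
  have h1 : ‖u‖ ≤ ‖u + v‖ + ‖v‖ := by simpa using norm_sub_le (u + v) v
  have h2 : κ * ‖u‖ ≤ 1 / 2 * ‖u‖ := by gcongr
  have h3 : κ * ‖u‖ ≤ κ * (2 * ‖v‖) := by gcongr; linarith
  linarith

/-- The deterministic estimate behind the asymptotic linearity of a root `θ` of `∑ sᵢ`. -/
theorem norm_sqrt_smul_add_le {ι E F : Type*} [NormedAddCommGroup E] [NormedSpace ℝ E]
    [NormedAddCommGroup F] [NormedSpace ℝ F] {s : ι → E → F} {θ₀ θ : E} {A : E →L[ℝ] F}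
    {L : F →L[ℝ] E} (hLA : ∀ v, L (A v) = v) {R : ι → ℝ} {T : Finset ι} {n : ℕ} (hn : n ≠ 0)
    (hroot : ∑ i ∈ T, s i θ = 0)
    (hlin : ∀ i, ‖s i θ - s i θ₀ - fderiv ℝ (s i) θ₀ (θ - θ₀)‖ ≤ R i * ‖θ - θ₀‖) {τ : ℝ}
    (hτ : 4 * ‖L‖ * τ ≤ 1) (hR : (n : ℝ)⁻¹ * ∑ i ∈ T, R i ≤ τ)
    (hA : ‖(n : ℝ)⁻¹ • ∑ i ∈ T, fderiv ℝ (s i) θ₀ - A‖ ≤ τ) :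
    ‖√(n : ℝ) • (θ - θ₀) + L ((√(n : ℝ))⁻¹ • ∑ i ∈ T, s i θ₀)‖ ≤
      4 * ‖L‖ * τ * ‖L ((√(n : ℝ))⁻¹ • ∑ i ∈ T, s i θ₀)‖ := by
  have hτ0 : 0 ≤ τ := (norm_nonneg _).trans hA
  set Δ := θ - θ₀ with hΔ
  set S := ∑ i ∈ T, s i θ₀ with hS
  set D := ∑ i ∈ T, fderiv ℝ (s i) θ₀ with hD
  -- Since `θ` is a root, `S + D Δ` is exactly minus the sum of the linearization errors.
  have h1 : ‖S + D Δ‖ ≤ (∑ i ∈ T, R i) * ‖Δ‖ := by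
    have : S + D Δ = -∑ i ∈ T, (s i θ - s i θ₀ - fderiv ℝ (s i) θ₀ Δ) := by
      simp only [Finset.sum_sub_distrib, hroot, hS, hD, _root_.sum_apply]
      abel
    rw [this, norm_neg, Finset.sum_mul]
    exact norm_sum_le_of_le _ fun i _ => hlin i
  have h2 : ‖(n : ℝ)⁻¹ • (S + D Δ)‖ ≤ τ * ‖Δ‖ := by
    rw [norm_smul, Real.norm_of_nonneg (by positivity)]
    calc (n : ℝ)⁻¹ * ‖S + D Δ‖ ≤ (n : ℝ)⁻¹ * ((∑ i ∈ T, R i) * ‖Δ‖) := by gcongr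
      _ = ((n : ℝ)⁻¹ * ∑ i ∈ T, R i) * ‖Δ‖ := by ring
      _ ≤ τ * ‖Δ‖ := by gcongr
  have h3 : ‖((n : ℝ)⁻¹ • D - A) Δ‖ ≤ τ * ‖Δ‖ :=
    (ContinuousLinearMap.le_opNorm _ _).trans (by gcongr)
  have h4 : Δ + L ((n : ℝ)⁻¹ • S) = L ((n : ℝ)⁻¹ • (S + D Δ) - ((n : ℝ)⁻¹ • D - A) Δ) := by
    have : (n : ℝ)⁻¹ • (S + D Δ) - ((n : ℝ)⁻¹ • D - A) Δ = A Δ + (n : ℝ)⁻¹ • S := by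
      simp only [_root_.sub_apply, _root_.smul_apply, smul_add]
      abel
    rw [this, map_add, hLA]
  have h5 : ‖Δ + L ((n : ℝ)⁻¹ • S)‖ ≤ (2 * ‖L‖ * τ) * ‖Δ‖ := by
    rw [h4]
    refine (ContinuousLinearMap.le_opNorm _ _).trans ?_
    calc ‖L‖ * _ ≤ ‖L‖ * (τ * ‖Δ‖ + τ * ‖Δ‖) := by
          gcongr; exact norm_sub_le_of_le h2 h3
      _ = _ := by ring
  have h6 := norm_add_le_of_norm_add_le_mul (by positivity) (by linarith) h5
  have hsq : √(n : ℝ) ≠ 0 := (Real.sqrt_pos.2 (Nat.cast_pos.2 (Nat.pos_of_ne_zero hn))).ne'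
  have h7 : L ((√(n : ℝ))⁻¹ • S) = √(n : ℝ) • L ((n : ℝ)⁻¹ • S) := by
    rw [← map_smul, smul_smul]
    congr 2
    nth_rw 3 [← Real.mul_self_sqrt (Nat.cast_nonneg n)]
    field_simp
  rw [h7, ← smul_add, norm_smul, norm_smul]
  calc ‖√(n : ℝ)‖ * ‖Δ + L ((n : ℝ)⁻¹ • S)‖
      ≤ ‖√(n : ℝ)‖ * (2 * (2 * ‖L‖ * τ) * ‖L ((n : ℝ)⁻¹ • S)‖) := by gcongr
    _ = _ := by ring

variable [IsProbabilityMeasure P]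

/-- A consistent root of an estimating equation is asymptotically linear. -/
theorem tendstoInMeasure_sqrt_smul_add {p : ℕ}
    {s : 𝓧 → EuclideanSpace ℝ (Fin p) → EuclideanSpace ℝ (Fin p)}
    {U : Set (EuclideanSpace ℝ (Fin p))} {θ₀ : EuclideanSpace ℝ (Fin p)} (hU : IsOpen U)
    (hθ₀ : θ₀ ∈ U) (hm : ∀ θ ∈ U, Measurable fun x => s x θ)
    (hd : ∀ x, DifferentiableOn ℝ (s x) U) {G : 𝓧 → ℝ} (hG : Integrable G ρ)
    (hGs : ∀ x, ∀ θ ∈ U, ‖fderiv ℝ (s x) θ‖ ≤ G x)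
    {L : EuclideanSpace ℝ (Fin p) →L[ℝ] EuclideanSpace ℝ (Fin p)}
    (hL : ∀ v, L ((∫ x, fderiv ℝ (s x) θ₀ ∂ρ) v) = v)
    (hlaw : ∀ i, HasLaw (X i) ρ P) (hindep : iIndepFun X P)
    (htight : ∀ η : ENNReal, 0 < η → ∃ M : ℝ, 0 < M ∧ ∀ n : ℕ,
      P {ω | M ≤ ‖L ((√(n : ℝ))⁻¹ • ∑ i ∈ Finset.range n, s (X i ω) θ₀)‖} ≤ η)
    {θhat : ℕ → Ω → EuclideanSpace ℝ (Fin p)}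
    (hroot : Tendsto (fun n : ℕ => P {ω | ∑ i ∈ Finset.range n, s (X i ω) (θhat n ω) ≠ 0})
      atTop (𝓝 0))
    (hcons : TendstoInMeasure P θhat atTop (fun _ => θ₀)) :
    TendstoInMeasure P (fun (n : ℕ) ω => √(n : ℝ) • (θhat n ω - θ₀) +
      L ((√(n : ℝ))⁻¹ • ∑ i ∈ Finset.range n, s (X i ω) θ₀)) atTop 0 := by
  set A := ∫ x, fderiv ℝ (s x) θ₀ ∂ρ with hA
  have hdm : StronglyMeasurable fun x => fderiv ℝ (s x) θ₀ :=
    stronglyMeasurable_fderiv_param hU hθ₀ hm fun x =>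
      (hd x).differentiableAt (hU.mem_nhds hθ₀)
  have hdi : Integrable (fun x => fderiv ℝ (s x) θ₀) ρ :=
    hG.mono' hdm.aestronglyMeasurable (ae_of_all _ fun x => hGs x θ₀ hθ₀)
  have hlln : TendstoInMeasure P
      (fun (n : ℕ) ω => (n : ℝ)⁻¹ • ∑ i ∈ Finset.range n, fderiv ℝ (s (X i ω)) θ₀) atTop
      fun _ => A := by
    have h := strong_law_ae (μ := P) (fun i ω => fderiv ℝ (s (X i ω)) θ₀)
      (integrable_comp_hasLaw (hlaw 0) hdi)
      (fun i j hij => (hindep.indepFun hij).comp hdm.measurable hdm.measurable)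
      (identDistrib_comp_hasLaw hlaw hdm.measurable)
    rw [integral_comp_hasLaw (hlaw 0) hdm.aestronglyMeasurable] at h
    refine tendstoInMeasure_of_tendsto_ae (fun n => ?_) h
    have hsum : AEStronglyMeasurable
        (fun ω => ∑ i ∈ Finset.range n, fderiv ℝ (s (X i ω)) θ₀) P :=
      Finset.aestronglyMeasurable_fun_sum _ fun i _ =>
        (integrable_comp_hasLaw (hlaw i) hdi).aestronglyMeasurable
    exact hsum.const_smul ((n : ℝ)⁻¹)
  rw [tendstoInMeasure_iff_norm] at hlln hcons
  rw [tendstoInMeasure_iff_norm]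
  intro ε hε
  refine ENNReal.tendsto_nhds_zero.2 fun η' hη' => ?_
  -- Five exceptional events will each receive probability at most `η < η' / 5`.
  obtain ⟨η, hη0, hη⟩ := ENNReal.lt_iff_exists_real_btwn.1 
    (ENNReal.div_pos hη'.ne' (by norm_num : (5 : ENNReal) ≠ ⊤))
  have hηpos : 0 < ENNReal.ofReal η := hη.1
  obtain ⟨M, hM, htight⟩ := htight _ hηpos
  -- The two bounds on `τ` are those for absorbing the error and for making it less than `ε` when
  -- the leading term is below `M`. Using `‖L‖ + 1` avoids dividing by zero.
  obtain ⟨τ, hτ, hτ1, hτ2⟩ : ∃ τ > 0, 4 * ‖L‖ * τ ≤ 1 ∧ 4 * ‖L‖ * τ * M < ε := by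
    have hL0 : 0 < ‖L‖ + 1 := by positivity
    refine ⟨min (1 / (4 * (‖L‖ + 1))) (ε / (4 * (‖L‖ + 1) * M)), by positivity, ?_, ?_⟩
    · calc 4 * ‖L‖ * _ ≤ 4 * ‖L‖ * (1 / (4 * (‖L‖ + 1))) := by gcongr; exact min_le_left _ _
        _ = ‖L‖ / (‖L‖ + 1) := by field_simp
        _ ≤ 1 := (div_le_one hL0).2 (by linarith)
    · calc 4 * ‖L‖ * _ * M ≤ 4 * ‖L‖ * (ε / (4 * (‖L‖ + 1) * M)) * M := by
            gcongr; exact min_le_right _ _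
        _ = ‖L‖ / (‖L‖ + 1) * ε := by field_simp
        _ < 1 * ε := by gcongr; exact (div_lt_one hL0).2 (by linarith)
        _ = ε := one_mul ε
  -- With `∫ R ≤ τ * η`, Markov's inequality gives probability at most `η` that the empirical mean
  -- of `R` reaches `τ`.
  obtain ⟨δ, hδ, R, -, hRi, hR0, hRint, hRlin⟩ :=
    exists_uniform_linearization hU hθ₀ hm hd hG hGs (mul_pos hτ (ENNReal.ofReal_pos.1 hηpos))
  filter_upwards [ENNReal.tendsto_nhds_zero.1 hroot _ hηpos,
    ENNReal.tendsto_nhds_zero.1 (hcons δ hδ) _ hηpos,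
    ENNReal.tendsto_nhds_zero.1 (hlln τ hτ) _ hηpos, eventually_ne_atTop 0] with n h1 h2 h3 hn
  have h4 : P {ω | τ ≤ (n : ℝ)⁻¹ * ∑ i ∈ Finset.range n, R (X i ω)} ≤ ENNReal.ofReal η :=
    (ENNReal.le_ofReal_iff_toReal_le (measure_ne_top _ _) hη0).2
      (measureReal_le_empirical_mean hlaw hRi hR0 hτ hRint hn)
  have h5 := htight n
  set B1 := {ω | ∑ i ∈ Finset.range n, s (X i ω) (θhat n ω) ≠ 0}
  set B2 := {ω | δ ≤ ‖θhat n ω - θ₀‖}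
  set B3 := {ω | τ ≤ ‖(n : ℝ)⁻¹ • ∑ i ∈ Finset.range n, fderiv ℝ (s (X i ω)) θ₀ - A‖}
  set B4 := {ω | τ ≤ (n : ℝ)⁻¹ * ∑ i ∈ Finset.range n, R (X i ω)}
  set B5 := {ω | M ≤ ‖L ((√(n : ℝ))⁻¹ • ∑ i ∈ Finset.range n, s (X i ω) θ₀)‖}
  have hsub : {ω | ε ≤ ‖√(n : ℝ) • (θhat n ω - θ₀) +
      L ((√(n : ℝ))⁻¹ • ∑ i ∈ Finset.range n, s (X i ω) θ₀) - (0 : Ω → EuclideanSpace ℝ (Fin p)) ω‖} ⊆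
      B1 ∪ B2 ∪ B3 ∪ B4 ∪ B5 := by
    intro ω hω
    by_contra hB
    simp only [B1, B2, B3, B4, B5, Set.mem_union, Set.mem_ofPred_eq, not_or, not_le, ne_eq,
      not_not] at hB
    obtain ⟨⟨⟨⟨g1, g2⟩, g3⟩, g4⟩, g5⟩ := hB
    have key := norm_sqrt_smul_add_le (s := fun i => s (X i ω)) hL hn g1
      (fun i => hRlin (X i ω) (θhat n ω) (by simpa [dist_eq_norm] using g2)) hτ1 g4.le g3.le
    simp only [Set.mem_ofPred_eq, Pi.zero_apply, sub_zero] at hω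
    have : 4 * ‖L‖ * τ * ‖L ((√(n : ℝ))⁻¹ • ∑ i ∈ Finset.range n, s (X i ω) θ₀)‖ ≤
      4 * ‖L‖ * τ * M := by gcongr
    linarith
  calc P _ ≤ P (B1 ∪ B2 ∪ B3 ∪ B4 ∪ B5) := measure_mono hsub
    _ ≤ P B1 + P B2 + P B3 + P B4 + P B5 := by
      refine (measure_union_le _ _).trans (add_le_add_left ?_ _)
      refine (measure_union_le _ _).trans (add_le_add_left ?_ _)
      refine (measure_union_le _ _).trans (add_le_add_left ?_ _)
      exact measure_union_le _ _
    _ ≤ ENNReal.ofReal η + ENNReal.ofReal η + ENNReal.ofReal η + ENNReal.ofReal η +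
        ENNReal.ofReal η := by gcongr
    _ = ENNReal.ofReal η * 5 := by ring
    _ ≤ η' / 5 * 5 := by gcongr; exact hη.2.le
    _ = η' := ENNReal.div_mul_cancel (by norm_num) (by norm_num)

end ZEstimator

theorem dotProduct_mulVec_eq_sum_prod {ι : Type*} [Fintype ι] (u : ι → ℝ) (M : Matrix ι ι ℝ) :
    u ⬝ᵥ M *ᵥ u = ∑ q : ι × ι, u q.1 * u q.2 * M q.1 q.2 := by
  simp only [dotProduct, Matrix.mulVec, Finset.mul_sum, Fintype.sum_prod_type]
  exact Finset.sum_congr rfl fun i _ => Finset.sum_congr rfl fun j _ => by ring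

/-! ### Regularity, derivative and moments of the score. -/

namespace GEE

section Score

variable {𝓩 : Type*} {m p : ℕ}

/-- The matrix `D(z, θ)ᵀ W(z, θ)`. -/
noncomputable def weightedJacobian (μ : 𝓩 → EuclideanSpace ℝ (Fin p) → EuclideanSpace ℝ (Fin m))
    (W : 𝓩 → EuclideanSpace ℝ (Fin p) → Matrix (Fin m) (Fin m) ℝ)
    (z : 𝓩) (θ : EuclideanSpace ℝ (Fin p)) : Matrix (Fin p) (Fin m) ℝ :=
  (jacobian μ z θ)ᵀ * W z θ

theorem score_apply (μ : 𝓩 → EuclideanSpace ℝ (Fin p) → EuclideanSpace ℝ (Fin m))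
    (W : 𝓩 → EuclideanSpace ℝ (Fin p) → Matrix (Fin m) (Fin m) ℝ)
    (x : 𝓩 × EuclideanSpace ℝ (Fin m)) (θ : EuclideanSpace ℝ (Fin p)) (a : Fin p) :
    score μ W x θ a = ∑ j, weightedJacobian μ W x.1 θ a j * (x.2 j - μ x.1 θ j) := rfl

theorem inner_score (μ : 𝓩 → EuclideanSpace ℝ (Fin p) → EuclideanSpace ℝ (Fin m))
    (W : 𝓩 → EuclideanSpace ℝ (Fin p) → Matrix (Fin m) (Fin m) ℝ)
    (x : 𝓩 × EuclideanSpace ℝ (Fin m)) (θ u : EuclideanSpace ℝ (Fin p)) :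
    inner ℝ (score μ W x θ) u =
      ∑ j, ((u : Fin p → ℝ) ᵥ* weightedJacobian μ W x.1 θ) j * (x.2 j - μ x.1 θ j) := by
  simp only [PiLp.inner_apply, score_apply, Matrix.vecMul, dotProduct, Finset.sum_mul,
    RCLike.inner_apply, conj_trivial, Finset.mul_sum]
  rw [Finset.sum_comm]
  exact Finset.sum_congr rfl fun j _ => Finset.sum_congr rfl fun a _ => by ring

variable [MeasurableSpace 𝓩] {ρ : Measure (𝓩 × EuclideanSpace ℝ (Fin m))}
  {μ : 𝓩 → EuclideanSpace ℝ (Fin p) → EuclideanSpace ℝ (Fin m)}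
  {W : 𝓩 → EuclideanSpace ℝ (Fin p) → Matrix (Fin m) (Fin m) ℝ}
  {θ₀ : EuclideanSpace ℝ (Fin p)} {U : Set (EuclideanSpace ℝ (Fin p))}

theorem Regular.differentiableAt_mean (hreg : Regular ρ μ W θ₀ U) (z : 𝓩)
    {θ : EuclideanSpace ℝ (Fin p)} (hθ : θ ∈ U) : DifferentiableAt ℝ (μ z) θ :=
  ((hreg.contDiffOn_mean z).differentiableOn (by norm_num)).differentiableAt
    (hreg.isOpen.mem_nhds hθ)

theorem Regular.contDiffOn_jacobian (hreg : Regular ρ μ W θ₀ U) (z : 𝓩) (j : Fin m) (a : Fin p) :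
    ContDiffOn ℝ 1 (fun θ => jacobian μ z θ j a) U := by
  have h := (hreg.contDiffOn_mean z).fderiv_of_isOpen hreg.isOpen (m := 1) (by norm_num)
  exact contDiffOn_euclidean.1 (h.clm_apply contDiffOn_const) j

theorem Regular.contDiffOn_weightedJacobian (hreg : Regular ρ μ W θ₀ U) (z : 𝓩) (a : Fin p)
    (j : Fin m) : ContDiffOn ℝ 1 (fun θ => weightedJacobian μ W z θ a j) U := by
  simp only [weightedJacobian, Matrix.mul_apply, Matrix.transpose_apply]
  exact ContDiffOn.sum fun l _ => (hreg.contDiffOn_jacobian z l a).mul (hreg.contDiffOn_weight z l j)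

theorem Regular.contDiffOn_score (hreg : Regular ρ μ W θ₀ U)
    (x : 𝓩 × EuclideanSpace ℝ (Fin m)) : ContDiffOn ℝ 1 (score μ W x) U := by
  refine contDiffOn_euclidean.2 fun a => ?_
  simp only [score_apply]
  refine ContDiffOn.sum fun j _ => (hreg.contDiffOn_weightedJacobian x.1 a j).mul ?_
  exact contDiffOn_const.sub
    (contDiffOn_euclidean.1 ((hreg.contDiffOn_mean x.1).of_le (by norm_num)) j)

theorem Regular.measurable_jacobian (hreg : Regular ρ μ W θ₀ U) {θ : EuclideanSpace ℝ (Fin p)}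
    (hθ : θ ∈ U) (j : Fin m) (a : Fin p) : Measurable fun z => jacobian μ z θ j a :=
  (EuclideanSpace.proj (𝕜 := ℝ) j).continuous.measurable.comp
    (measurable_fderiv_param_apply hreg.isOpen hθ hreg.measurable_mean
      (fun z => hreg.differentiableAt_mean z hθ) (EuclideanSpace.single a 1))

theorem Regular.measurable_weightedJacobian (hreg : Regular ρ μ W θ₀ U)
    {θ : EuclideanSpace ℝ (Fin p)} (hθ : θ ∈ U) (a : Fin p) (j : Fin m) :
    Measurable fun z => weightedJacobian μ W z θ a j := by
  simp only [weightedJacobian, Matrix.mul_apply, Matrix.transpose_apply]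
  exact Finset.measurable_fun_sum _ fun l _ =>
    (hreg.measurable_jacobian hθ l a).mul (hreg.measurable_weight θ hθ l j)

theorem Regular.measurable_mean_apply (hreg : Regular ρ μ W θ₀ U)
    {θ : EuclideanSpace ℝ (Fin p)} (hθ : θ ∈ U) (j : Fin m) : Measurable fun z => μ z θ j :=
  (EuclideanSpace.proj (𝕜 := ℝ) j).continuous.measurable.comp (hreg.measurable_mean θ hθ)

theorem Regular.measurable_score (hreg : Regular ρ μ W θ₀ U) {θ : EuclideanSpace ℝ (Fin p)}
    (hθ : θ ∈ U) : Measurable fun x => score μ W x θ := by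
  refine (WithLp.measurable_toLp 2 _).comp (measurable_pi_lambda _ fun a => ?_)
  change Measurable fun x => score μ W x θ a
  simp only [score_apply]
  refine Finset.measurable_fun_sum _ fun j _ =>
    ((hreg.measurable_weightedJacobian hθ a j).comp measurable_fst).mul ?_
  exact ((EuclideanSpace.proj (𝕜 := ℝ) j).continuous.measurable.comp measurable_snd).sub
    ((hreg.measurable_mean_apply hθ j).comp measurable_fst)

/-- Product rule: differentiating `Dᵀ W` leaves a term linear in the residual, and differentiating
`-μ` gives `-Dᵀ W D`. -/
theorem Regular.fderiv_score_apply (hreg : Regular ρ μ W θ₀ U)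
    (x : 𝓩 × EuclideanSpace ℝ (Fin m)) (a b : Fin p) :
    fderiv ℝ (score μ W x) θ₀ (EuclideanSpace.single b 1) a =
      ∑ j, fderiv ℝ (fun θ => weightedJacobian μ W x.1 θ a j) θ₀ (EuclideanSpace.single b 1) *
        (x.2 j - μ x.1 θ₀ j) - breadIntegrand μ W θ₀ x a b := by
  have hU := hreg.isOpen.mem_nhds hreg.mem
  have hB (j : Fin m) := (((hreg.contDiffOn_weightedJacobian x.1 a j).differentiableOn
    one_ne_zero).differentiableAt hU).hasFDerivAt
  have hμ := (hreg.differentiableAt_mean x.1 hreg.mem).hasFDerivAt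
  have hμj (j : Fin m) : HasFDerivAt (fun θ => μ x.1 θ j) _ θ₀ :=
    (EuclideanSpace.proj (𝕜 := ℝ) j).hasFDerivAt.comp θ₀ hμ
  have hs := (((hreg.contDiffOn_score x).differentiableOn
    one_ne_zero).differentiableAt hU).hasFDerivAt
  have h1 : HasFDerivAt (fun θ => score μ W x θ a) _ θ₀ :=
    (EuclideanSpace.proj (𝕜 := ℝ) a).hasFDerivAt.comp θ₀ hs
  have h2 : HasFDerivAt (fun θ => score μ W x θ a) _ θ₀ :=
    HasFDerivAt.fun_sum (u := Finset.univ) fun j _ => (hB j).mul ((hμj j).const_sub (x.2 j))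
  have h3 := DFunLike.congr_fun (h1.unique h2) (EuclideanSpace.single b 1)
  have h4 : breadIntegrand μ W θ₀ x a b = ∑ j, weightedJacobian μ W x.1 θ₀ a j *
      fderiv ℝ (μ x.1) θ₀ (EuclideanSpace.single b 1) j := rfl
  rw [h4, ← Finset.sum_sub_distrib]
  refine h3.trans ?_
  rw [_root_.sum_apply]
  refine Finset.sum_congr rfl fun j _ => ?_
  simp
  ring

end Score

section Moments

variable {𝓩 : Type*} {m p : ℕ} [MeasurableSpace 𝓩] {ρ : Measure (𝓩 × EuclideanSpace ℝ (Fin m))}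
  {μ : 𝓩 → EuclideanSpace ℝ (Fin p) → EuclideanSpace ℝ (Fin m)}
  {W : 𝓩 → EuclideanSpace ℝ (Fin p) → Matrix (Fin m) (Fin m) ℝ}
  {θ₀ : EuclideanSpace ℝ (Fin p)} {U : Set (EuclideanSpace ℝ (Fin p))}

theorem comap_fst_le :
    MeasurableSpace.comap (Prod.fst : 𝓩 × EuclideanSpace ℝ (Fin m) → 𝓩) inferInstance ≤
      inferInstanceAs (MeasurableSpace (𝓩 × EuclideanSpace ℝ (Fin m))) :=
  measurable_fst.comap_le

theorem measurable_comp_fst_comap {f : 𝓩 → ℝ} (hf : Measurable f) :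
    Measurable[MeasurableSpace.comap Prod.fst inferInstance]
      fun x : 𝓩 × EuclideanSpace ℝ (Fin m) => f x.1 :=
  hf.comp (comap_measurable _)

theorem Regular.memLp_outcome (hreg : Regular ρ μ W θ₀ U) (j : Fin m) :
    MemLp (fun x : 𝓩 × EuclideanSpace ℝ (Fin m) => x.2 j) 2 ρ :=
  hreg.memLp.eval_piLp j

theorem Regular.trueCov_ae_eq (hreg : Regular ρ μ W θ₀ U) (j l : Fin m) :
    (fun x => trueCov ρ x j l) =ᵐ[ρ]
      condZ ρ fun x => (x.2 j - μ x.1 θ₀ j) * (x.2 l - μ x.1 θ₀ l) := by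
  refine condExp_congr_ae ?_
  filter_upwards [hreg.mean j, hreg.mean l] with x hj hl
  rw [hj, hl]

theorem Regular.isHermitian_J (hreg : Regular ρ μ W θ₀ U) : (J ρ μ W θ₀).IsHermitian := by
  ext a b
  have h (x : 𝓩 × EuclideanSpace ℝ (Fin m)) :
      breadIntegrand μ W θ₀ x b a = breadIntegrand μ W θ₀ x a b := by
    have : (breadIntegrand μ W θ₀ x)ᵀ = breadIntegrand μ W θ₀ x := by
      simp [breadIntegrand, Matrix.transpose_mul, (hreg.symm_weight x.1 θ₀ hreg.mem).eq,
        Matrix.mul_assoc]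
    exact congrFun (congrFun this a) b
  simp [J, h]

theorem Regular.memLp_residual (hreg : Regular ρ μ W θ₀ U) (j : Fin m) :
    MemLp (fun x : 𝓩 × EuclideanSpace ℝ (Fin m) => x.2 j - μ x.1 θ₀ j) 2 ρ := by
  have h : MemLp (condZ ρ fun x => x.2 j) 2 ρ :=
    MemLp.condExp (by norm_num) (hreg.memLp_outcome j)
  exact (hreg.memLp_outcome j).sub (h.ae_eq (hreg.mean j))

variable [IsProbabilityMeasure ρ]

theorem Regular.condZ_residual (hreg : Regular ρ μ W θ₀ U) (j : Fin m) :
    condZ ρ (fun x => x.2 j - μ x.1 θ₀ j) =ᵐ[ρ] 0 := by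
  have hY := (hreg.memLp_outcome j).integrable (by norm_num)
  have hμ : Integrable (fun x : 𝓩 × EuclideanSpace ℝ (Fin m) => μ x.1 θ₀ j) ρ :=
    integrable_condExp.congr (hreg.mean j)
  have h1 := condExp_sub hY hμ (MeasurableSpace.comap Prod.fst inferInstance)
  have h2 : condZ ρ (fun x => μ x.1 θ₀ j) = fun x => μ x.1 θ₀ j :=
    condExp_of_stronglyMeasurable comap_fst_le
      (measurable_comp_fst_comap (hreg.measurable_mean_apply hreg.mem j)).stronglyMeasurable hμ
  filter_upwards [h1, hreg.mean j] with x hx1 hx2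
  have h3 := congrFun h2 x
  unfold condZ at hx2 h3 ⊢
  refine hx1.trans ?_
  rw [Pi.sub_apply, hx2, h3, sub_self, Pi.zero_apply]

/-- `E[∂ₑ s] = -J`: the derivative of the weights does not contribute. -/
theorem Regular.integral_fderiv_score (hreg : Regular ρ μ W θ₀ U) (a b : Fin p) :
    (∫ x, fderiv ℝ (score μ W x) θ₀ ∂ρ) (EuclideanSpace.single b 1) a = -J ρ μ W θ₀ a b := by
  obtain ⟨G, hG, hGs⟩ := hreg.dominated
  have hU := hreg.isOpen.mem_nhds hreg.mem
  have hint : Integrable (fun x => fderiv ℝ (score μ W x) θ₀) ρ :=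
    hG.mono' (stronglyMeasurable_fderiv_param hreg.isOpen hreg.mem
      (fun θ hθ => hreg.measurable_score hθ) fun x => ((hreg.contDiffOn_score x).differentiableOn
        one_ne_zero).differentiableAt hU).aestronglyMeasurable
      (ae_of_all _ fun x => hGs x θ₀ hreg.mem)
  have hint' := hint.apply_continuousLinearMap (EuclideanSpace.single b 1)
  rw [ContinuousLinearMap.integral_apply hint, eval_integral_piLp fun i => hint'.eval_piLp i]
  simp only [hreg.fderiv_score_apply]
  -- Domination controls the whole derivative only, so integrability of this sum is read off from
  -- the derivative plus `Dᵀ W D`; its terms need not be integrable.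
  have hres : Integrable (fun x : 𝓩 × EuclideanSpace ℝ (Fin m) =>
      ∑ j, fderiv ℝ (fun θ => weightedJacobian μ W x.1 θ a j) θ₀ (EuclideanSpace.single b 1) *
        (x.2 j - μ x.1 θ₀ j)) ρ := by
    refine ((hint'.eval_piLp a).add (hreg.integrable_J a b)).congr (ae_of_all _ fun x => ?_)
    simp only [Pi.add_apply, hreg.fderiv_score_apply, sub_add_cancel]
  rw [integral_sub hres (hreg.integrable_J a b)]
  have hw (j : Fin m) : Measurable fun z =>
      fderiv ℝ (fun θ => weightedJacobian μ W z θ a j) θ₀ (EuclideanSpace.single b 1) :=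
    measurable_fderiv_param_apply hreg.isOpen hreg.mem
      (fun θ hθ => hreg.measurable_weightedJacobian hθ a j)
      (fun z => ((hreg.contDiffOn_weightedJacobian z a j).differentiableOn
        one_ne_zero).differentiableAt hU) _
  have hzero : (fun x => ∑ j, fderiv ℝ (fun θ => weightedJacobian μ W x.1 θ a j) θ₀
      (EuclideanSpace.single b 1) * condZ ρ (fun x => x.2 j - μ x.1 θ₀ j) x) =ᵐ[ρ] 0 := by
    filter_upwards [ae_all_iff.2 hreg.condZ_residual] with x hx
    simp [hx]
  have h := (integral_sum_mul_condExp comap_fst_le (fun j => measurable_comp_fst_comap (hw j))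
    (fun j => (hreg.memLp_residual j).integrable (by norm_num)) hres
    ((integrable_zero _ _ _).congr hzero.symm)).trans (integral_congr_ae hzero)
  rw [h]
  simp [J]

/-- The square of a linear functional of the score has the expectation given by `K`. -/
theorem Regular.integrable_and_integral_inner_score_sq (hreg : Regular ρ μ W θ₀ U)
    (u : EuclideanSpace ℝ (Fin p)) :
    Integrable (fun x => inner ℝ (score μ W x θ₀) u ^ 2) ρ ∧
      ∫ x, inner ℝ (score μ W x θ₀) u ^ 2 ∂ρ = u ⬝ᵥ K ρ μ W θ₀ *ᵥ u := by
  set c : 𝓩 → Fin m → ℝ := fun z => (u : Fin p → ℝ) ᵥ* weightedJacobian μ W z θ₀ with hc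
  have hcm (j : Fin m) : Measurable fun z => c z j := by
    simp only [hc, Matrix.vecMul, dotProduct]
    exact Finset.measurable_fun_sum _ fun a _ =>
      (hreg.measurable_weightedJacobian hreg.mem a j).const_mul _
  set e : 𝓩 × EuclideanSpace ℝ (Fin m) → Fin m → ℝ := fun x j => x.2 j - μ x.1 θ₀ j with he
  -- The squared projection is a quadratic form in the residuals with coefficients depending on `z`
  -- alone; conditioning on `z` turns residual products into entries of `Σ`.
  have hsq (x : 𝓩 × EuclideanSpace ℝ (Fin m)) : inner ℝ (score μ W x θ₀) u ^ 2 =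
      ∑ q : Fin m × Fin m, c x.1 q.1 * c x.1 q.2 * (e x q.1 * e x q.2) := by
    rw [inner_score, sq, Finset.sum_mul_sum, Fintype.sum_prod_type]
    exact Finset.sum_congr rfl fun j _ => Finset.sum_congr rfl fun l _ => by ring
  have hmeat : (fun x => ∑ q : Fin m × Fin m, c x.1 q.1 * c x.1 q.2 *
        condZ ρ (fun x => e x q.1 * e x q.2) x) =ᵐ[ρ]
      fun x => ∑ q : Fin p × Fin p, u q.1 * u q.2 * meatIntegrand ρ μ W θ₀ x q.1 q.2 := by
    filter_upwards [ae_all_iff.2 fun q : Fin m × Fin m => hreg.trueCov_ae_eq q.1 q.2] with x hx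
    rw [← dotProduct_mulVec_eq_sum_prod (u : Fin p → ℝ) (meatIntegrand ρ μ W θ₀ x)]
    have h1 : meatIntegrand ρ μ W θ₀ x =
        weightedJacobian μ W x.1 θ₀ * trueCov ρ x * (weightedJacobian μ W x.1 θ₀)ᵀ := by
      rw [weightedJacobian, Matrix.transpose_mul, Matrix.transpose_transpose,
        (hreg.symm_weight x.1 θ₀ hreg.mem).eq, meatIntegrand]
      simp only [Matrix.mul_assoc]
    rw [h1, ← Matrix.mulVec_mulVec, ← Matrix.mulVec_mulVec, Matrix.dotProduct_mulVec,
      Matrix.mulVec_transpose, dotProduct_mulVec_eq_sum_prod]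
    exact Finset.sum_congr rfl fun q _ => by rw [hx q]
  have hint : Integrable (fun x => ∑ q : Fin p × Fin p,
      u q.1 * u q.2 * meatIntegrand ρ μ W θ₀ x q.1 q.2) ρ :=
    integrable_finsetSum _ fun q _ => (hreg.integrable_K q.1 q.2).const_mul _
  have hw (q : Fin m × Fin m) : Measurable[MeasurableSpace.comap Prod.fst inferInstance]
      fun x : 𝓩 × EuclideanSpace ℝ (Fin m) => c x.1 q.1 * c x.1 q.2 :=
    measurable_comp_fst_comap ((hcm q.1).mul (hcm q.2))
  have hg (q : Fin m × Fin m) : Integrable (fun x => e x q.1 * e x q.2) ρ :=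
    (hreg.memLp_residual q.1).integrable_mul (hreg.memLp_residual q.2)
  have hi := integrable_sum_mul_of_condExp comap_fst_le hw hg
    (fun x => (hsq x).symm ▸ sq_nonneg _) (hint.congr hmeat.symm)
  simp only [hsq]
  refine ⟨hi, ?_⟩
  refine (integral_sum_mul_condExp comap_fst_le hw hg hi (hint.congr hmeat.symm)).trans
    ((integral_congr_ae hmeat).trans ?_)
  rw [dotProduct_mulVec_eq_sum_prod,
    integral_finsetSum _ fun q _ => (hreg.integrable_K q.1 q.2).const_mul _]
  exact Finset.sum_congr rfl fun q _ => integral_const_mul _ _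

/-- The second moments of the coordinates are the diagonal entries of `K`. -/
theorem Regular.memLp_score (hreg : Regular ρ μ W θ₀ U) :
    MemLp (fun x => score μ W x θ₀) 2 ρ := by
  refine MemLp.of_eval_piLp fun a => ?_
  have hm : Measurable fun x => score μ W x θ₀ a :=
    (EuclideanSpace.proj (𝕜 := ℝ) a).continuous.measurable.comp (hreg.measurable_score hreg.mem)
  refine (memLp_two_iff_integrable_sq hm.aestronglyMeasurable).2 ?_
  simpa [EuclideanSpace.inner_single_right] using
    (hreg.integrable_and_integral_inner_score_sq (EuclideanSpace.single a 1)).1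

theorem Regular.posSemidef_K (hreg : Regular ρ μ W θ₀ U) : (K ρ μ W θ₀).PosSemidef := by
  refine Matrix.PosSemidef.of_dotProduct_mulVec_nonneg ?_ fun u => ?_
  · ext a b
    have h : (fun x => meatIntegrand ρ μ W θ₀ x b a) = fun x => meatIntegrand ρ μ W θ₀ x a b := by
      ext x
      have hcov : (trueCov ρ x)ᵀ = trueCov ρ x := by
        ext j l
        simp [trueCov, mul_comm]
      have : (meatIntegrand ρ μ W θ₀ x)ᵀ = meatIntegrand ρ μ W θ₀ x := by
        simp [meatIntegrand, Matrix.transpose_mul, (hreg.symm_weight x.1 θ₀ hreg.mem).eq, hcov,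
          Matrix.mul_assoc]
      exact congrFun (congrFun this a) b
    simp [K, h]
  · have h := (hreg.integrable_and_integral_inner_score_sq (WithLp.toLp 2 u)).2
    rw [star_trivial, ← h]
    exact integral_nonneg fun x => sq_nonneg _

end Moments

end GEE

/-! ### From `√n`-tightness to the logarithmic rates. -/

section Rates

theorem IsBigOInProbWith.mono {Ω E : Type*} [MeasurableSpace Ω] [NormedAddCommGroup E]
    {C : ℝ → ℝ} {P : Measure Ω} {X : ℕ → Ω → E} {r r' : ℕ → ℝ} (h : IsBigOInProbWith C P X r)
    (hC : ∀ ε, 0 ≤ C ε) (hr : ∀ n, r n ≤ r' n) : IsBigOInProbWith C P X r' := fun ε hε => by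
  filter_upwards [h ε hε] with n hn
  refine (measure_mono fun ω hω => ?_).trans hn
  exact (mul_le_mul_of_nonneg_left (hr n) (hC ε)).trans_lt hω

/-- A `√n`-tight sequence is `O_P(√(log n / (n c)))`, with constants that do not depend on `c`. -/
theorem isBigOInProbWith_sqrt_log_div {Ω E : Type*} [MeasurableSpace Ω] [NormedAddCommGroup E]
    [NormedSpace ℝ E] {P : Measure Ω} {X : ℕ → Ω → E}
    (h : ∀ η : ENNReal, 0 < η → ∃ M : ℝ, 0 < M ∧ ∀ n : ℕ, P {ω | M ≤ ‖√(n : ℝ) • X n ω‖} ≤ η)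
    {c : ℝ} (hc : 0 < c) :
    IsBigOInProbWith (fun _ => 1) P X fun n => √(Real.log n / (n * c)) := by
  intro ε hε
  obtain ⟨M, hM, hMn⟩ := h _ (ENNReal.ofReal_pos.2 hε)
  -- Once `log n ≥ M² c`, the rate is at least `M / √n`; hence the constant `1` works for every `ε`.
  have hlog := (Real.tendsto_log_atTop.comp
    tendsto_natCast_atTop_atTop).eventually_ge_atTop (M ^ 2 * c)
  filter_upwards [hlog, eventually_gt_atTop 0] with n hn hn0
  refine (measure_mono fun ω hω => ?_).trans (hMn n)
  simp only [Set.mem_ofPred_eq, one_mul, Function.comp_apply] at hω hn ⊢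
  have hn' : (0 : ℝ) < n := Nat.cast_pos.2 hn0
  have h1 : M / √(n : ℝ) ≤ √(Real.log n / (n * c)) := by
    refine Real.le_sqrt_of_sq_le ?_
    rw [div_pow, Real.sq_sqrt hn'.le, div_le_div_iff₀ hn' (by positivity)]
    nlinarith
  rw [norm_smul, Real.norm_of_nonneg (Real.sqrt_nonneg _)]
  have h2 := (div_le_iff₀' (Real.sqrt_pos.2 hn')).1 (h1.trans hω.le)
  exact h2

theorem sqrt_div_le_rpow_mul_sqrt_div {a l l' x : ℝ} (hx : 0 ≤ x) (ha : 0 < a) (hl' : 0 < l')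
    (h : a * l' ≤ l) {n : ℝ} (hn : 0 ≤ n) :
    √(x / (n * l)) ≤ a ^ (-(1 / 2) : ℝ) * √(x / (n * l')) := by
  have h1 : a ^ (-(1 / 2) : ℝ) = √(a⁻¹) := by
    rw [Real.rpow_neg ha.le, ← Real.sqrt_eq_rpow, Real.sqrt_inv]
  rw [h1, ← Real.sqrt_mul (inv_nonneg.2 ha.le)]
  refine Real.sqrt_le_sqrt ?_
  -- For `n = 0` both quotients are divisions by zero, hence zero.
  rcases hn.eq_or_lt with rfl | hn
  · simp
  · calc x / (n * l) ≤ x / (n * (a * l')) := by gcongr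
      _ = a⁻¹ * (x / (n * l')) := by field_simp

end Rates

/-! ### The limit law of the estimator. -/

namespace GEE

variable {Ω 𝓩 : Type*} [MeasurableSpace Ω] [MeasurableSpace 𝓩] {m p : ℕ}
  {P : Measure Ω} [IsProbabilityMeasure P]
  {ρ : Measure (𝓩 × EuclideanSpace ℝ (Fin m))} [IsProbabilityMeasure ρ]
  {μ : 𝓩 → EuclideanSpace ℝ (Fin p) → EuclideanSpace ℝ (Fin m)}
  {W : 𝓩 → EuclideanSpace ℝ (Fin p) → Matrix (Fin m) (Fin m) ℝ}
  {θ₀ : EuclideanSpace ℝ (Fin p)} {U : Set (EuclideanSpace ℝ (Fin p))}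

theorem Regular.integral_fderiv_score_eq (hreg : Regular ρ μ W θ₀ U) :
    ∫ x, fderiv ℝ (score μ W x) θ₀ ∂ρ = -Matrix.toEuclideanCLM (𝕜 := ℝ) (J ρ μ W θ₀) := by
  refine ContinuousLinearMap.coe_injective
    ((EuclideanSpace.basisFun (Fin p) ℝ).toBasis.ext fun b => ?_)
  ext a
  simp [hreg.integral_fderiv_score a b]

theorem Regular.posSemidef_sandwich (hreg : Regular ρ μ W θ₀ U) :
    ((J ρ μ W θ₀)⁻¹ * K ρ μ W θ₀ * (J ρ μ W θ₀)⁻¹).PosSemidef := by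
  have h := hreg.posSemidef_K.mul_mul_conjTranspose_same (J ρ μ W θ₀)⁻¹
  rwa [hreg.isHermitian_J.inv.eq] at h

variable {X : ℕ → Ω → 𝓩 × EuclideanSpace ℝ (Fin m)}

/-- The central limit theorem for the influence function `J⁻¹ s` of a root. -/
theorem Regular.tendstoInDistribution_influence (hreg : Regular ρ μ W θ₀ U)
    (hlaw : ∀ i, HasLaw (X i) ρ P) (hindep : iIndepFun X P)
    (hpop : ∫ x, score μ W x θ₀ ∂ρ = 0) :
    TendstoInDistribution (fun (n : ℕ) ω => (√(n : ℝ))⁻¹ • ∑ i ∈ Finset.range n,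
        Matrix.toEuclideanCLM (𝕜 := ℝ) (J ρ μ W θ₀)⁻¹ (score μ W (X i ω) θ₀)) atTop id
      (fun _ => P)
      (multivariateGaussian 0 ((J ρ μ W θ₀)⁻¹ * K ρ μ W θ₀ * (J ρ μ W θ₀)⁻¹)) := by
  set N := Matrix.toEuclideanCLM (𝕜 := ℝ) (J ρ μ W θ₀)⁻¹ with hN
  have hsm : Measurable fun x => N (score μ W x θ₀) :=
    N.continuous.measurable.comp (hreg.measurable_score hreg.mem)
  have hL2 : MemLp (fun x => N (score μ W x θ₀)) 2 ρ := N.comp_memLp' hreg.memLp_score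
  have hint := hL2.integrable (by norm_num : (1 : ENNReal) ≤ 2)
  have hJ := hreg.isHermitian_J.inv
  refine tendstoInDistribution_multivariateGaussian
    (ξ := fun i ω => N (score μ W (X i ω) θ₀)) hreg.posSemidef_sandwich ?_ ?_ ?_
    (hindep.comp (fun _ x => N (score μ W x θ₀)) fun _ => hsm) (identDistrib_comp_hasLaw hlaw hsm)
  · rw [← (hlaw 0).map_eq] at hL2
    exact hL2.comp_of_map (hlaw 0).aemeasurable
  · rw [integral_comp_hasLaw (hlaw 0) hint.aestronglyMeasurable,
      N.integral_comp_comm (hreg.memLp_score.integrable (by norm_num)), hpop, map_zero]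
  · intro t
    -- Symmetry of `J⁻¹` moves it onto `t`, so the variance in direction `t` is the quadratic form
    -- of `K` at `J⁻¹ t`.
    have hadj x : inner ℝ (N (score μ W x θ₀)) t = inner ℝ (score μ W x θ₀) (N t) := by
      rw [real_inner_comm, hN, Matrix.inner_toEuclideanCLM, Matrix.dotProduct_mulVec, real_inner_comm,
        PiLp.inner_apply]
      have : (t : Fin p → ℝ) ᵥ* (J ρ μ W θ₀)⁻¹ = (J ρ μ W θ₀)⁻¹ *ᵥ t := by
        have hT : ((J ρ μ W θ₀)⁻¹)ᵀ = (J ρ μ W θ₀)⁻¹ := hJ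
        rw [← Matrix.mulVec_transpose, hT]
      rw [this]
      simp [dotProduct, mul_comm]
    have hf : AEStronglyMeasurable (fun x => inner ℝ (N (score μ W x θ₀)) t ^ 2) ρ :=
      (hint.aestronglyMeasurable.inner_const).pow 2
    rw [integral_comp_hasLaw (f := fun x => inner ℝ (N (score μ W x θ₀)) t ^ 2) (hlaw 0) hf]
    simp only [hadj]
    rw [(hreg.integrable_and_integral_inner_score_sq (N t)).2, hN]
    have hT : ((J ρ μ W θ₀)⁻¹)ᵀ = (J ρ μ W θ₀)⁻¹ := hJ
    rw [Matrix.ofLp_toEuclideanCLM, ← Matrix.mulVec_mulVec, ← Matrix.mulVec_mulVec,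
      Matrix.dotProduct_mulVec (t : Fin p → ℝ), ← Matrix.mulVec_transpose, hT]

/-- Asymptotic normality of a consistent root, with the sandwich covariance. -/
theorem Regular.tendstoInDistribution_root (hreg : Regular ρ μ W θ₀ U)
    (hlaw : ∀ i, HasLaw (X i) ρ P) (hindep : iIndepFun X P)
    (hpop : ∫ x, score μ W x θ₀ ∂ρ = 0) (hJ : 0 < lambdaMin (J ρ μ W θ₀))
    {θhat : ℕ → Ω → EuclideanSpace ℝ (Fin p)} (hmeas : ∀ n, AEMeasurable (θhat n) P)
    (hroot : Tendsto
      (fun n : ℕ => P {ω | ∑ i ∈ Finset.range n, score μ W (X i ω) (θhat n ω) ≠ 0}) atTop (𝓝 0))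
    (hcons : TendstoInMeasure P θhat atTop (fun _ => θ₀)) :
    TendstoInDistribution (fun (n : ℕ) ω => √(n : ℝ) • (θhat n ω - θ₀)) atTop id (fun _ => P)
      (multivariateGaussian 0 ((J ρ μ W θ₀)⁻¹ * K ρ μ W θ₀ * (J ρ μ W θ₀)⁻¹)) := by
  have hclt := hreg.tendstoInDistribution_influence hlaw hindep hpop
  set N := Matrix.toEuclideanCLM (𝕜 := ℝ) (J ρ μ W θ₀)⁻¹ with hN
  have hinv : (J ρ μ W θ₀)⁻¹ * J ρ μ W θ₀ = 1 :=
    Matrix.nonsing_inv_mul _ (posDef_of_lambdaMin_pos hreg.isHermitian_J hJ).det_pos.ne'.isUnit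
  have hsum (n : ℕ) ω : (-N) ((√(n : ℝ))⁻¹ • ∑ i ∈ Finset.range n, score μ W (X i ω) θ₀) =
      -((√(n : ℝ))⁻¹ • ∑ i ∈ Finset.range n, N (score μ W (X i ω) θ₀)) := by
    simp [map_sum]
  obtain ⟨G, hG, hGs⟩ := hreg.dominated
  -- The choice `L = -J⁻¹` inverts the mean derivative `-J`, and the central limit theorem supplies
  -- the tightness of the leading term.
  have hlin := tendstoInMeasure_sqrt_smul_add (L := -N) hreg.isOpen hreg.mem
    (fun θ hθ => hreg.measurable_score hθ)
    (fun x => (hreg.contDiffOn_score x).differentiableOn one_ne_zero) hG hGs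
    (fun v => by
      rw [hreg.integral_fderiv_score_eq]
      have h : (N * Matrix.toEuclideanCLM (𝕜 := ℝ) (J ρ μ W θ₀)) v = v := by
        rw [hN, ← map_mul, hinv, map_one]
        rfl
      simpa using h)
    hlaw hindep
    (fun η hη => by
      simp only [hsum, norm_neg]
      exact hclt.exists_measure_le_norm_le hη)
    hroot hcons
  -- Slutsky: the estimator differs from the normalized influence sum by a term vanishing in
  -- probability.
  refine tendstoInDistribution_of_tendstoInMeasure_sub _ _ hclt ?_
    fun n => ((hmeas n).sub_const θ₀).const_smul (√(n : ℝ))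
  refine hlin.congr_left fun n => ae_of_all _ fun ω => ?_
  simp only [hsum, sub_eq_add_neg, Pi.add_apply, Pi.neg_apply]

end GEE

theorem mainTheorem8
    {Ω 𝓩 : Type*} [MeasurableSpace Ω] [MeasurableSpace 𝓩] {m p : ℕ}
    (P : Measure Ω) [IsProbabilityMeasure P]
    (ρ : Measure (𝓩 × EuclideanSpace ℝ (Fin m))) [IsProbabilityMeasure ρ]
    (μ : 𝓩 → EuclideanSpace ℝ (Fin p) → EuclideanSpace ℝ (Fin m))
    (W : 𝓩 → EuclideanSpace ℝ (Fin p) → Matrix (Fin m) (Fin m) ℝ)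
    (θ₀ : EuclideanSpace ℝ (Fin p)) (U : Set (EuclideanSpace ℝ (Fin p)))
    (hreg : GEE.Regular ρ μ W θ₀ U)
    -- the clusters `X i = (Z i, Y i)` are independent with law `ρ`
    (X : ℕ → Ω → 𝓩 × EuclideanSpace ℝ (Fin m))
    (hlaw : ∀ i, HasLaw (X i) ρ P) (hindep : iIndepFun X P)
    -- `θ₀` solves the population estimating equation
    (hpop : ∫ x, GEE.score μ W x θ₀ ∂ρ = 0)
    (hJ : 0 < lambdaMin (GEE.J ρ μ W θ₀))
    -- `θhat` is a consistent root
    (θhat : ℕ → Ω → EuclideanSpace ℝ (Fin p)) (hmeas : ∀ n, AEMeasurable (θhat n) P)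
    (hroot : Tendsto
      (fun n : ℕ => P {ω | ∑ i ∈ Finset.range n, GEE.score μ W (X i ω) (θhat n ω) ≠ 0})
      atTop (𝓝 0))
    (hcons : TendstoInMeasure P θhat atTop (fun _ => θ₀)) :
    (∃ C : ℝ → ℝ,
      IsBigOInProbWith C P (fun n ω => θhat n ω - θ₀)
        (fun n => √(Real.log n / (n * lambdaMin (GEE.J ρ μ W θ₀)))) ∧
      ∀ (k d : ℕ) (Q : Fin k → ℝ) (h : Fin k → EuclideanSpace ℝ (Fin d))
        (α : EuclideanSpace ℝ (Fin p) → EuclideanSpace ℝ (Fin d)) (Pstar : Fin k → ℝ)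
        (V : OrthonormalBasis (Fin p) ℝ (InfoGeom.tangent h)) (a b : ℝ),
        (∀ x, 0 < Q x) → ∑ x, Q x = 1 → InfoGeom.IsInfoProjection Q h (α θ₀) Pstar →
        0 < a →
        (GEE.J ρ μ W θ₀ - a • InfoGeom.hessian V Pstar).PosSemidef →
        (b • InfoGeom.hessian V Pstar - GEE.J ρ μ W θ₀).PosSemidef →
        (∀ n : ℕ, √(Real.log n / (n * lambdaMin (GEE.J ρ μ W θ₀))) ≤
          a ^ (-(1 / 2) : ℝ) *
            √(Real.log n / (n * lambdaMin (InfoGeom.hessian V Pstar)))) ∧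
        IsBigOInProbWith C P (fun n ω => θhat n ω - θ₀)
          (fun n => a ^ (-(1 / 2) : ℝ) *
            √(Real.log n / (n * lambdaMin (InfoGeom.hessian V Pstar))))) ∧
    ((GEE.J ρ μ W θ₀)⁻¹ * GEE.K ρ μ W θ₀ * (GEE.J ρ μ W θ₀)⁻¹).PosSemidef ∧
    TendstoInDistribution (fun (n : ℕ) ω => √(n : ℝ) • (θhat n ω - θ₀)) atTop id
      (fun _ => P)
      (multivariateGaussian 0
        ((GEE.J ρ μ W θ₀)⁻¹ * GEE.K ρ μ W θ₀ * (GEE.J ρ μ W θ₀)⁻¹)) := by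

  have hnormal := hreg.tendstoInDistribution_root hlaw hindep hpop hJ hmeas hroot hcons
  have hrate := isBigOInProbWith_sqrt_log_div (X := fun n ω => θhat n ω - θ₀)
    (fun η hη => hnormal.exists_measure_le_norm_le hη) hJ
  -- The constant function `1` is fixed before `Pstar`, `V`, `a` and `b`, which gives the required
  -- uniformity.
  refine ⟨⟨fun _ => 1, hrate, ?_⟩, hreg.posSemidef_sandwich, hnormal⟩
  intro k d Q h α Pstar V a b _ _ hproj ha hlower _
  have hp := pos_of_lambdaMin_pos hJ
  have hH := InfoGeom.hessian_posDef V hproj.1.1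
  have hle (n : ℕ) := sqrt_div_le_rpow_mul_sqrt_div (Real.log_natCast_nonneg n) ha
    (hH.lambdaMin_pos hp) (mul_lambdaMin_le hp hreg.isHermitian_J hH.1 ha.le hlower) n.cast_nonneg
  exact ⟨hle, hrate.mono (fun _ => zero_le_one) hle⟩
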